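/- Let $n\ge k\ge 1$ be integers and let $S$ be a non-empty family of $k$-element subsets of $[n]=\{1,\dots,n\}$. The shadow $\Delta(S)$ is the family of all $(k-1)$-subsets contained in some member of $S$; put $\Delta^0(S)=S$ and $\Delta^{i}(S)=\Delta(\Delta^{i-1}(S))$. Let $|S|=\binom{a_0}{k}+\binom{a_1}{k-1}+\cdots+\binom{a_t}{k-t}$, with $a_0>a_1>\cdots>a_t\ge k-t\ge 1$, $0\le t\le k-1$, be the (unique) $k$-binomial decomposition of $|S|$. The family $S$ is called extremal if it attains equality in the Kruskal--Katona bound, that is, if $$|\Delta(S)|=\binom{a_0}{k-1}+\binom{a_1}{k-2}+\cdots+\binom{a_t}{k-t-1}.$$ For $x\in\mathbb Z$ let $\binom{x}{j}=\frac{x(x-1)\cdots(x-j+1)}{j!}$ for integers $j\ge 1$, $\binom{x}{0}=1$, and $\binom{x}{j}=0$ for integers $j<0$. The shadow $k$-binomial decomposition of $S$ is the sequence of (not necessarily positive) integers $\beta_0>\beta_1>\cdots>\beta_{k-2}\ge\beta_{k-1}$ such that, for each $0\le i\le k-1$, $$|\Delta^i(S)|=\binom{\beta_0}{k-i}+\binom{\beta_1}{k-i-1}+\cdots+\binom{\beta_{k-1}}{1-i}.$$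 Theorem. The shadow $k$-binomial decomposition $(\beta_0,\dots,\beta_{k-1})$ of $S$ exists and is unique, and $S$ is extremal if and only if $\beta_{k-1}\ge 1$. -/

import Mathlib

/-- The binomial coefficient `n choose j` for all integers `n` and `j`: it is
`n (n - 1) ⋯ (n - j + 1) / j!` for `j ≥ 0` (so `1` for `j = 0`), and `0` for `j < 0`. -/
def intBinom (n j : ℤ) : ℤ :=
  if j < 0 then 0 else Ring.choose n j.toNat

/-- `(a 0, …, a t)` is the `k`-binomial decomposition of `m`: `0 ≤ t ≤ k - 1`,
`a 0 > a 1 > ⋯ > a t ≥ k - t`, and `m = ∑ i ≤ t, (a i choose (k - i))`. -/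
def IsBinomialDecomposition (k m t : ℕ) (a : Fin (t + 1) → ℕ) : Prop :=
  t < k ∧ StrictAnti a ∧ k - t ≤ a (Fin.last t) ∧
    m = ∑ i : Fin (t + 1), (a i).choose (k - i)

/-- A family `S` of `k`-sets is extremal: its shadow attains the Kruskal–Katona lower bound
`∑ i ≤ t, (a i choose (k - i - 1))`, where `a` is the `k`-binomial decomposition of `|S|`. -/
def IsKruskalKatonaExtremal {n : ℕ} (k : ℕ) (S : Finset (Finset (Fin n))) : Prop :=
  ∃ (t : ℕ) (a : Fin (t + 1) → ℕ), IsBinomialDecomposition k S.card t a ∧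
    S.shadow.card = ∑ i : Fin (t + 1), (a i).choose (k - i - 1)

/-- `(β 0, …, β (k - 1))` is the shadow `k`-binomial decomposition of the family `S`:
a sequence of integers with `β 0 > β 1 > ⋯ > β (k - 2) ≥ β (k - 1)` such that the `i`-th iterated
shadow of `S` has cardinality `∑ j < k, (β j choose (k - i - j))`, for all `0 ≤ i ≤ k - 1`. -/
def IsShadowBinomialDecomposition {n k : ℕ} (S : Finset (Finset (Fin n))) (β : Fin k → ℤ) : Prop :=
  Antitone β ∧
  (∀ i j : Fin k, i < j → (j : ℕ) + 1 < k → β j < β i) ∧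
  ∀ i : Fin k, (((Finset.shadow^[(i : ℕ)] S).card : ℕ) : ℤ) =
    ∑ j : Fin k, intBinom (β j) ((k : ℤ) - (i : ℤ) - (j : ℤ))

/-! Let v(m) count the m-sets in the complex generated by S, with v(m) = 0 for m > k; thus v(0) = 1.
The equations v(m) = ∑_{j ≤ m} C(B_j, m - j) are triangular, since B_m enters v(m+1) linearly with
coefficient 1, so they have a unique integer solution B. The shadow decomposition agrees with B
except at the end: the equation for |S| has no room for the final term C(·, 0) = 1, so β_{k-1} =
B_{k-1} + 1. It remains to show that B is strictly decreasing (whence the weak last inequality for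
β) and that S is extremal exactly when B_{k-1} ≥ 0.

Monotonicity. While the B_j are nonnegative, v(m+1) is a cascade plus 1, and Kruskal–Katona in the
form v(m+2) ≤ `kkUpper (m+1) (v(m+1))` says precisely B_{m+1} < B_m. From the first negative B_p on,
it bounds v by the cascade of the first p terms, so the tail sums are nonpositive; a sign argument
for the series ∑ x^i (1+x)^{B_i} then gives strict decrease (`strictAnti_of_cascade_nonpos`).

Extremality. If all B_j ≥ 0, rewriting "cascade plus 1" as a genuine cascade gives equality in the
bound. Conversely, an extremal family has the least shadow for its size, and so does its shadow
(`HasMinimalShadow.shadow`). By induction on the rank the earlier B_j are nonnegative; if the last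
were negative, a family with a smaller shadow could have just as many members.

Inheritance of minimality is the hard part. Complementation turns shadows into cliques, and the
claim becomes: if W has the maximal number of cliques, so does its family of cliques. This is proved
together with the clique bound, by splitting W at a point and tracking equality
(`cliqueBound_and_cascadeBound`). -/

/-! ### Arithmetic of the cascade function -/

/-- The largest number of `(q + 1)`-sets all of whose `q`-subsets lie in a family of `m` sets of
size `q ≥ 1`, given by the cascade recursion. -/
def kkUpper : ℕ → ℕ → ℕ
  | 0, _ => 0
  | q + 1, m =>
    (Nat.findGreatest (fun n => n.choose (q + 1) ≤ m) (m + q)).choose (q + 2) +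
      kkUpper q (m - (Nat.findGreatest (fun n => n.choose (q + 1) ≤ m) (m + q)).choose (q + 1))

theorem lt_choose_add (q m : ℕ) : m < (m + q + 1).choose (q + 1) := by
  induction m with
  | zero => simp
  | succ m ih =>
    have e : (m + 1 + q + 1).choose (q + 1) =
        (m + q + 1).choose q + (m + q + 1).choose (q + 1) := by
      rw [show m + 1 + q + 1 = (m + q + 1) + 1 by ring, Nat.choose_succ_succ']
    have : 0 < (m + q + 1).choose q := Nat.choose_pos (by omega)
    omega

theorem exists_choose_le_lt (q m : ℕ) :
    ∃ n : ℕ, n.choose (q + 1) ≤ m ∧ m < (n + 1).choose (q + 1) := by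
  have h : ∃ n : ℕ, m < (n + 1).choose (q + 1) := ⟨m + q, lt_choose_add q m⟩
  classical
  refine ⟨Nat.find h, ?_, Nat.find_spec h⟩
  rcases hn : Nat.find h with _ | n
  · simp
  · exact not_lt.1 (Nat.find_min h (m := n) (by omega))

theorem kkUpper_rec {q m n : ℕ} (h1 : n.choose (q + 1) ≤ m) (h2 : m < (n + 1).choose (q + 1)) :
    kkUpper (q + 1) m = n.choose (q + 2) + kkUpper q (m - n.choose (q + 1)) := by
  have key : Nat.findGreatest (fun n => n.choose (q + 1) ≤ m) (m + q) = n := by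
    apply le_antisymm
    · by_contra! hlt
      have := Nat.findGreatest_spec (P := fun n => n.choose (q + 1) ≤ m) (m := 0) (n := m + q)
        (by omega) (by simp)
      have h3 := Nat.choose_le_choose (q + 1) (Nat.succ_le_of_lt hlt)
      simp only [Nat.succ_eq_add_one] at h3
      omega
    · refine Nat.le_findGreatest (P := fun n => n.choose (q + 1) ≤ m) ?_ h1
      by_contra! hlt
      have h3 := Nat.choose_le_choose (q + 1) (Nat.succ_le_of_lt hlt)
      have := lt_choose_add q m
      simp only [Nat.succ_eq_add_one] at h3
      omega
  rw [kkUpper, key]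

@[simp] theorem kkUpper_zero_left (m : ℕ) : kkUpper 0 m = 0 := rfl

@[simp] theorem kkUpper_zero_right (q : ℕ) : kkUpper q 0 = 0 := by
  induction q with
  | zero => rfl
  | succ q ih =>
    rw [kkUpper_rec (n := q)] <;> simp [ih, Nat.choose_eq_zero_of_lt]

theorem kkUpper_one (m : ℕ) : kkUpper 1 m = m.choose 2 := by
  rw [kkUpper_rec (n := m)] <;> simp

theorem kkUpper_full (q n : ℕ) :
    kkUpper (q + 1) (n.choose (q + 1)) = n.choose (q + 2) := by
  rcases Nat.lt_or_ge n q with h | h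
  · rw [Nat.choose_eq_zero_of_lt (by omega), Nat.choose_eq_zero_of_lt (by omega)]; simp
  · rw [kkUpper_rec (n := n) le_rfl]
    · simp
    · have e := Nat.choose_succ_succ' n q
      have := Nat.choose_pos h
      omega

/-- The greedy recursion survives at the boundary m = C(n, q+1), where Pascal's rule turns both
sides into full values at n + 1. Hence later cascades need not be normalized. -/
theorem kkUpper_add {q n m : ℕ} (h : m ≤ n.choose (q + 1)) :
    kkUpper (q + 2) (n.choose (q + 2) + m) = n.choose (q + 3) + kkUpper (q + 1) m := by
  have e : (n + 1).choose (q + 2) = n.choose (q + 1) + n.choose (q + 2) :=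
    Nat.choose_succ_succ' n (q + 1)
  have e' : (n + 1).choose (q + 3) = n.choose (q + 2) + n.choose (q + 3) :=
    Nat.choose_succ_succ' n (q + 2)
  rcases h.lt_or_eq with h | rfl
  · rw [kkUpper_rec (q := q + 1) (n := n) (Nat.le_add_right _ _)]
    · rw [Nat.add_sub_cancel_left]
    · show n.choose (q + 2) + m < (n + 1).choose (q + 2)
      rw [e]; omega
  · rw [kkUpper_full, add_comm (n.choose (q + 2)), ← e, kkUpper_full (q + 1), e', add_comm]

/-- Splitting off the leading term of a cascade. -/
theorem exists_eq_choose_add (q m : ℕ) :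
    ∃ n m' : ℕ, m = n.choose (q + 1) + m' ∧ m' < n.choose q := by
  obtain ⟨n, h1, h2⟩ := exists_choose_le_lt q m
  have e := Nat.choose_succ_succ' n q
  exact ⟨n, m - n.choose (q + 1), by omega, by omega⟩

theorem kkUpper_mono (q : ℕ) : Monotone (kkUpper q) := by
  induction q with
  | zero => exact fun _ _ _ => le_rfl
  | succ q ih =>
    rcases q with _ | q
    · intro a b hab
      rw [kkUpper_one, kkUpper_one]
      exact Nat.choose_le_choose 2 hab
    · refine monotone_nat_of_le_succ fun m => ?_
      obtain ⟨n, m', rfl, h⟩ := exists_eq_choose_add (q + 1) m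
      rw [add_assoc (n.choose _)]
      refine (kkUpper_add h.le).trans_le (le_of_le_of_eq ?_ (kkUpper_add h).symm)
      exact Nat.add_le_add_left (ih (Nat.le_succ _)) _

/-- The condition q + 2 ≤ n is needed: for n = q + 1 the right side vanishes. -/
theorem kkUpper_lt_full {q n m : ℕ} (hn : q + 2 ≤ n) (h : m < n.choose (q + 1)) :
    kkUpper (q + 1) m < n.choose (q + 2) := by
  induction q generalizing n m with
  | zero =>
    rw [kkUpper_one]
    simp only [zero_add, Nat.choose_one_right] at h ⊢
    obtain ⟨n, rfl⟩ : ∃ k, n = k + 1 := ⟨n - 1, by omega⟩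
    have := Nat.choose_le_choose 2 (Nat.lt_succ_iff.1 h)
    have e : (n + 1).choose 2 = n.choose 1 + n.choose 2 := Nat.choose_succ_succ' n 1
    rw [Nat.choose_one_right] at e
    omega
  | succ q ih =>
    obtain ⟨n, rfl⟩ : ∃ k, n = k + 1 := ⟨n - 1, by omega⟩
    have e : (n + 1).choose (q + 2) = n.choose (q + 1) + n.choose (q + 2) :=
      Nat.choose_succ_succ' n (q + 1)
    have e' : (n + 1).choose (q + 3) = n.choose (q + 2) + n.choose (q + 3) :=
      Nat.choose_succ_succ' n (q + 2)
    show kkUpper (q + 2) m < (n + 1).choose (q + 3)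
    replace h : m < (n + 1).choose (q + 2) := h
    rcases Nat.lt_or_ge m (n.choose (q + 2)) with h1 | h1
    · have h2 := kkUpper_mono (q + 2) h1.le
      rw [kkUpper_full (q + 1)] at h2
      have : 0 < n.choose (q + 2) := Nat.choose_pos (by omega)
      rw [e']
      exact lt_of_le_of_lt h2 (Nat.lt_add_of_pos_left this)
    · obtain ⟨m', rfl⟩ := Nat.exists_eq_add_of_le h1
      rw [kkUpper_add (by omega), e']
      have := ih (n := n) (m := m') (by omega) (by omega)
      omega

theorem choose_le_of_le_kkUpper {q n a : ℕ} (hn : q + 2 ≤ n)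
    (h : n.choose (q + 2) ≤ kkUpper (q + 1) a) : n.choose (q + 1) ≤ a := by
  by_contra! h1
  exact absurd (kkUpper_lt_full hn h1) (not_lt.2 h)

theorem kkUpper_le_full {q n m : ℕ} (h : m ≤ n.choose (q + 1)) :
    kkUpper (q + 1) m ≤ n.choose (q + 2) := by
  rw [← kkUpper_full]; exact kkUpper_mono _ h

/-- By Pascal's rule the leading terms of b and of `kkUpper (q + 1) b` merge into one at n + 1, and
the remainders satisfy the same relation. This settles the equality case in which the cliques
through a point x are exactly the members avoiding x, joined to x. -/
theorem kkUpper_cone (q b : ℕ) :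
    kkUpper (q + 2) (b + kkUpper (q + 1) b) ≤
      kkUpper (q + 1) b + kkUpper (q + 2) (kkUpper (q + 1) b) := by
  induction q generalizing b with
  | zero =>
    have e : (b + 1).choose 2 = b.choose 1 + b.choose 2 := Nat.choose_succ_succ' b 1
    have e' : (b + 1).choose 3 = b.choose 2 + b.choose 3 := Nat.choose_succ_succ' b 2
    rw [Nat.choose_one_right] at e
    rw [zero_add, kkUpper_one, ← e, kkUpper_full 1, kkUpper_full 1, ← e']
  | succ q ih =>
    obtain ⟨n, b, rfl, h⟩ := exists_eq_choose_add (q + 1) b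
    have e : (n + 1).choose (q + 2) = n.choose (q + 1) + n.choose (q + 2) :=
      Nat.choose_succ_succ' n (q + 1)
    have e' : (n + 1).choose (q + 3) = n.choose (q + 2) + n.choose (q + 3) :=
      Nat.choose_succ_succ' n (q + 2)
    have e'' : (n + 1).choose (q + 4) = n.choose (q + 3) + n.choose (q + 4) :=
      Nat.choose_succ_succ' n (q + 3)
    have h0 : kkUpper (q + 2) (n.choose (q + 2) + b) = n.choose (q + 3) + kkUpper (q + 1) b :=
      kkUpper_add h.le
    have h1 := kkUpper_le_full h.le
    have h2 : kkUpper (q + 3) ((n + 1).choose (q + 3) + (b + kkUpper (q + 1) b)) =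
        (n + 1).choose (q + 4) + kkUpper (q + 2) (b + kkUpper (q + 1) b) :=
      kkUpper_add (q := q + 1) (by show _ ≤ (n + 1).choose (q + 2); omega)
    have h3 : kkUpper (q + 3) (n.choose (q + 3) + kkUpper (q + 1) b) =
        n.choose (q + 4) + kkUpper (q + 2) (kkUpper (q + 1) b) := kkUpper_add (q := q + 1) h1
    have h4 := ih b
    show kkUpper (q + 3) (n.choose (q + 2) + b + kkUpper (q + 2) (n.choose (q + 2) + b)) ≤
      kkUpper (q + 2) (n.choose (q + 2) + b) +
        kkUpper (q + 3) (kkUpper (q + 2) (n.choose (q + 2) + b))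
    rw [h0, h3, show n.choose (q + 2) + b + (n.choose (q + 3) + kkUpper (q + 1) b) =
      (n + 1).choose (q + 3) + (b + kkUpper (q + 1) b) by rw [e']; ring, h2]
    omega

/-- The leading term of b forces a matching leading term in a; Pascal's rule combines them in a + b,
and induction treats the remainders. -/
theorem kkUpper_add_self_le {q a b : ℕ} (h : b ≤ kkUpper (q + 1) a) :
    kkUpper (q + 2) b + b ≤ kkUpper (q + 2) (a + b) := by
  rcases Nat.eq_zero_or_pos b with rfl | hb
  · simp
  induction q generalizing a b with
  | zero =>
    obtain ⟨n, b, rfl, hb'⟩ := exists_eq_choose_add 1 b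
    rw [Nat.choose_one_right] at hb'
    simp only [Nat.reduceAdd, zero_add] at *
    have e : (n + 1).choose 2 = n.choose 1 + n.choose 2 := Nat.choose_succ_succ' n 1
    have e3 : (n + 1).choose 3 = n.choose 2 + n.choose 3 := Nat.choose_succ_succ' n 2
    have eb : (b + 1).choose 2 = b.choose 1 + b.choose 2 := Nat.choose_succ_succ' b 1
    rw [Nat.choose_one_right] at e eb
    have hn : 2 ≤ n := by
      by_contra! hn
      rw [Nat.choose_eq_zero_of_lt hn] at hb
      omega
    have ha : n.choose 1 ≤ a := choose_le_of_le_kkUpper (q := 0) hn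
      (by simpa using (Nat.le_add_right _ _).trans h)
    rw [Nat.choose_one_right] at ha
    have h0 : kkUpper 2 (n.choose 2 + b) = n.choose 3 + kkUpper 1 b :=
      kkUpper_add (q := 0) (by simpa using hb'.le)
    have h1 : kkUpper 2 ((n + 1).choose 2 + (b + 1)) = (n + 1).choose 3 + kkUpper 1 (b + 1) :=
      kkUpper_add (q := 0) (by simpa using hb'.le)
    rw [kkUpper_one] at h0 h1
    rcases ha.eq_or_lt with rfl | ha
    · rw [kkUpper_one] at h
      obtain rfl : b = 0 := by omega
      rw [show n + (n.choose 2 + 0) = (n + 1).choose 2 by rw [e]; ring, kkUpper_full 1,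
        show (n + 1).choose (1 + 2) = _ from e3, h0]
      simp; omega
    · have h2 : kkUpper 2 ((n + 1).choose 2 + (b + 1)) ≤ kkUpper 2 (a + (n.choose 2 + b)) :=
        kkUpper_mono _ (by omega)
      omega
  | succ q ih =>
    obtain ⟨n, b, rfl, hb'⟩ := exists_eq_choose_add (q + 2) b
    simp only [Nat.add_assoc, Nat.reduceAdd] at *
    have hn : q + 3 ≤ n := by
      by_contra! hn
      rw [Nat.choose_eq_zero_of_lt hn] at hb
      rcases Nat.lt_or_ge n (q + 2) with h1 | h1
      · rw [Nat.choose_eq_zero_of_lt h1] at hb'; omega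
      · obtain rfl : n = q + 2 := by omega
        rw [Nat.choose_self] at hb'; omega
    have ha : n.choose (q + 2) ≤ a :=
      choose_le_of_le_kkUpper (q := q + 1) hn ((Nat.le_add_right _ _).trans h)
    obtain ⟨a', rfl⟩ := Nat.exists_eq_add_of_le ha
    have e1 : (n + 1).choose (q + 2) = n.choose (q + 1) + n.choose (q + 2) :=
      Nat.choose_succ_succ' n (q + 1)
    have e2 : (n + 1).choose (q + 3) = n.choose (q + 2) + n.choose (q + 3) :=
      Nat.choose_succ_succ' n (q + 2)
    have e3 : (n + 1).choose (q + 4) = n.choose (q + 3) + n.choose (q + 4) :=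
      Nat.choose_succ_succ' n (q + 3)
    have h0 : kkUpper (q + 3) (n.choose (q + 3) + b) = n.choose (q + 4) + kkUpper (q + 2) b :=
      kkUpper_add (q := q + 1) hb'.le
    -- The remainder of a is replaced by c, the smaller of a' and C(n, q+1), so that c + b is at
    -- most C(n+1, q+2) and the leading term can be split off.
    have key : ∀ c, c ≤ a' → c ≤ n.choose (q + 1) → b ≤ kkUpper (q + 1) c →
        kkUpper (q + 3) (n.choose (q + 3) + b) + (n.choose (q + 3) + b) ≤
        kkUpper (q + 3) (n.choose (q + 2) + a' + (n.choose (q + 3) + b)) := by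
      intro c h1 h2 h3
      have h4 : kkUpper (q + 2) b + b ≤ kkUpper (q + 2) (c + b) := by
        rcases Nat.eq_zero_or_pos b with rfl | hb
        · simp
        · exact ih h3 hb
      have h5 : kkUpper (q + 3) ((n + 1).choose (q + 3) + (c + b)) =
          (n + 1).choose (q + 4) + kkUpper (q + 2) (c + b) :=
        kkUpper_add (q := q + 1) (by show _ ≤ (n + 1).choose (q + 2); omega)
      have h6 : kkUpper (q + 3) ((n + 1).choose (q + 3) + (c + b)) ≤
          kkUpper (q + 3) (n.choose (q + 2) + a' + (n.choose (q + 3) + b)) :=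
        kkUpper_mono _ (by omega)
      omega
    rcases le_total a' (n.choose (q + 1)) with h1 | h1
    · refine key a' le_rfl h1 ?_
      rw [kkUpper_add h1] at h
      omega
    · refine key _ h1 le_rfl ?_
      rw [kkUpper_full]
      exact hb'.le

/-! ### Cliques, splitting at a point, and extremal families -/

/-- The `(q + 1)`-subsets of `V` all of whose subsets obtained by deleting one element lie
in `W`. -/
def cliques {α : Type*} [DecidableEq α] (V : Finset α) (q : ℕ) (W : Finset (Finset α)) :
    Finset (Finset α) :=
  (V.powersetCard (q + 1)).filter fun D => ∀ x ∈ D, D.erase x ∈ W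

section cliques

variable {α : Type*} [DecidableEq α] {V U : Finset α} {q : ℕ} {W A B : Finset (Finset α)} {x : α}

open Finset

theorem mem_cliques {D : Finset α} :
    D ∈ cliques V q W ↔ (D ⊆ V ∧ #D = q + 1) ∧ ∀ x ∈ D, D.erase x ∈ W := by
  simp [cliques, mem_powersetCard]

theorem cliques_subset_powersetCard : cliques V q W ⊆ V.powersetCard (q + 1) :=
  filter_subset _ _

theorem cliques_mono (h : A ⊆ B) : cliques V q A ⊆ cliques V q B := fun D hD => by
  rw [mem_cliques] at hD ⊢
  exact ⟨hD.1, fun x hx => h (hD.2 x hx)⟩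

@[simp] theorem cliques_empty : cliques V q (∅ : Finset (Finset α)) = ∅ := by
  ext D
  simp only [mem_cliques, notMem_empty, iff_false, not_and, imp_false]
  rintro ⟨-, h⟩ h'
  obtain ⟨x, hx⟩ : D.Nonempty := card_pos.1 (by omega)
  exact h' x hx

theorem cliques_powersetCard : cliques V q (V.powersetCard q) = V.powersetCard (q + 1) := by
  ext D
  simp only [mem_cliques, mem_powersetCard, and_iff_left_iff_imp]
  rintro ⟨h, hc⟩ x hx
  exact ⟨(erase_subset _ _).trans h, by rw [card_erase_of_mem hx, hc]; rfl⟩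

theorem nonMemberSubfamily_cliques (hx : x ∉ U) :
    (cliques (insert x U) q W).nonMemberSubfamily x =
      cliques U q (W.nonMemberSubfamily x) := by
  ext D
  simp only [mem_nonMemberSubfamily, mem_cliques]
  constructor
  · rintro ⟨⟨⟨h1, h2⟩, h3⟩, h4⟩
    exact ⟨⟨(subset_insert_iff_of_notMem h4).1 h1, h2⟩,
      fun y hy => ⟨h3 y hy, fun h => h4 (mem_of_mem_erase h)⟩⟩
  · rintro ⟨⟨h1, h2⟩, h3⟩
    exact ⟨⟨⟨h1.trans (subset_insert _ _), h2⟩, fun y hy => (h3 y hy).1⟩, fun h => hx (h1 h)⟩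

/-- In a clique D ∪ {x}, deleting x asks for D ∈ W, and deleting any other point asks for D to be a
clique of the link of x. This is the recursion behind all the counting below. -/
theorem memberSubfamily_cliques (hx : x ∉ U) :
    (cliques (insert x U) (q + 1) W).memberSubfamily x =
      W.nonMemberSubfamily x ∩ cliques U q (W.memberSubfamily x) := by
  ext D
  simp only [mem_memberSubfamily, mem_nonMemberSubfamily, mem_cliques, mem_inter]
  constructor
  · rintro ⟨⟨⟨h1, h2⟩, h3⟩, h4⟩
    rw [card_insert_of_notMem h4] at h2
    refine ⟨⟨by simpa [h4] using h3 x (mem_insert_self _ _), h4⟩,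
      ⟨⟨(insert_subset_insert_iff h4).1 h1, by omega⟩, fun y hy => ⟨?_, ?_⟩⟩⟩
    · have := h3 y (mem_insert_of_mem hy)
      rwa [erase_insert_of_ne (ne_of_mem_of_not_mem hy h4).symm] at this
    · exact fun h => h4 (mem_of_mem_erase h)
  · rintro ⟨⟨h1, h4⟩, ⟨⟨h2, h3⟩, h5⟩⟩
    refine ⟨⟨⟨insert_subset_insert _ h2, by rw [card_insert_of_notMem h4, h3]⟩, ?_⟩, h4⟩
    intro y hy
    rcases mem_insert.1 hy with rfl | hy
    · rwa [erase_insert h4]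
    · rw [erase_insert_of_ne (ne_of_mem_of_not_mem hy h4).symm]
      exact (h5 y hy).1

theorem card_cliques_insert (hx : x ∉ U) :
    #(cliques (insert x U) (q + 1) W) =
      #(cliques U (q + 1) (W.nonMemberSubfamily x)) +
        #(W.nonMemberSubfamily x ∩ cliques U q (W.memberSubfamily x)) := by
  rw [← card_memberSubfamily_add_card_nonMemberSubfamily x, memberSubfamily_cliques hx,
    nonMemberSubfamily_cliques hx, add_comm]

theorem card_cliques_cliques_insert (hx : x ∉ U) :
    #(cliques (insert x U) (q + 2) (cliques (insert x U) (q + 1) W)) =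
      #(cliques U (q + 2) (cliques U (q + 1) (W.nonMemberSubfamily x))) +
        #(cliques U (q + 1) (W.nonMemberSubfamily x) ∩
          cliques U (q + 1) (W.nonMemberSubfamily x ∩ cliques U q (W.memberSubfamily x))) := by
  rw [card_cliques_insert hx, memberSubfamily_cliques hx, nonMemberSubfamily_cliques hx]

theorem nonMemberSubfamily_subset_powersetCard (h : W ⊆ (insert x U).powersetCard q) :
    W.nonMemberSubfamily x ⊆ U.powersetCard q := fun D hD => by
  rw [mem_nonMemberSubfamily] at hD
  have := mem_powersetCard.1 (h hD.1)
  exact mem_powersetCard.2 ⟨(subset_insert_iff_of_notMem hD.2).1 this.1, this.2⟩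

theorem memberSubfamily_subset_powersetCard (h : W ⊆ (insert x U).powersetCard (q + 1)) :
    W.memberSubfamily x ⊆ U.powersetCard q := fun D hD => by
  rw [mem_memberSubfamily] at hD
  have := mem_powersetCard.1 (h hD.1)
  rw [card_insert_of_notMem hD.2] at this
  exact mem_powersetCard.2 ⟨(insert_subset_insert_iff hD.2).1 this.1, by omega⟩

/-- A family on `insert x U` with prescribed subfamilies of the sets avoiding and containing `x`. -/
theorem exists_subfamilies_eq (hx : x ∉ U) (hA : A ⊆ U.powersetCard (q + 1))
    (hB : B ⊆ U.powersetCard q) :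
    ∃ W ⊆ (insert x U).powersetCard (q + 1), W.nonMemberSubfamily x = A ∧
      W.memberSubfamily x = B := by
  have hA' : ∀ D ∈ A, x ∉ D := fun D hD h => hx ((mem_powersetCard.1 (hA hD)).1 h)
  have hB' : ∀ D ∈ B, x ∉ D := fun D hD h => hx ((mem_powersetCard.1 (hB hD)).1 h)
  refine ⟨A ∪ B.image (insert x), ?_, ?_, ?_⟩
  · intro D hD
    rcases mem_union.1 hD with h | h
    · have := mem_powersetCard.1 (hA h)
      exact mem_powersetCard.2 ⟨this.1.trans (subset_insert _ _), this.2⟩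
    · obtain ⟨E, hE, rfl⟩ := mem_image.1 h
      have := mem_powersetCard.1 (hB hE)
      exact mem_powersetCard.2 ⟨insert_subset_insert _ this.1, by
        rw [card_insert_of_notMem (hB' E hE), this.2]⟩
  · ext D
    simp only [mem_nonMemberSubfamily, mem_union, mem_image]
    constructor
    · rintro ⟨h | ⟨E, -, rfl⟩, h'⟩
      · exact h
      · simp at h'
    · exact fun h => ⟨Or.inl h, hA' D h⟩
  · ext D
    simp only [mem_memberSubfamily, mem_union, mem_image]
    constructor
    · rintro ⟨h | ⟨E, hE, h⟩, h'⟩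
      · exact absurd (mem_insert_self x D) (hA' _ h)
      · rwa [← erase_insert h', ← h, erase_insert (hB' E hE)]
    · exact fun h => ⟨Or.inr ⟨D, h, rfl⟩, hB' D h⟩

/-- The families are built like colexicographic initial segments: stay inside U while there is room,
otherwise take all (q+1)-sets of U and join x to an extremal family of q-sets. -/
theorem exists_card_cliques_eq (V : Finset α) (q m : ℕ) (hm : m ≤ (#V).choose (q + 1)) :
    ∃ W ⊆ V.powersetCard (q + 1), #W = m ∧ #(cliques V (q + 1) W) = kkUpper (q + 1) m ∧
      #(cliques V (q + 2) (cliques V (q + 1) W)) = kkUpper (q + 2) (kkUpper (q + 1) m) := by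
  induction V using Finset.induction_on generalizing q m with
  | empty =>
    obtain rfl : m = 0 := by simpa using hm
    exact ⟨∅, by simp⟩
  | insert x U hx ih =>
    rw [card_insert_of_notMem hx] at hm
    have e : (#U + 1).choose (q + 1) = (#U).choose q + (#U).choose (q + 1) :=
      Nat.choose_succ_succ' _ _
    rcases le_or_gt m ((#U).choose (q + 1)) with h1 | h1
    · obtain ⟨A, hA, hA1, hA2, hA3⟩ := ih q m h1
      obtain ⟨W, hW, rfl, hW1⟩ := exists_subfamilies_eq hx hA (empty_subset _)
      refine ⟨W, hW, ?_, ?_, ?_⟩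
      · rw [← card_memberSubfamily_add_card_nonMemberSubfamily x, hW1, hA1]; simp
      · rw [card_cliques_insert hx, hW1, hA2]; simp
      · rw [card_cliques_cliques_insert hx, hW1, hA3]; simp
    rcases hm.eq_or_lt with rfl | h2
    · refine ⟨_, Subset.rfl, ?_, ?_, ?_⟩
      · rw [card_powersetCard, card_insert_of_notMem hx]
      · rw [cliques_powersetCard, card_powersetCard, card_insert_of_notMem hx, kkUpper_full]
      · rw [cliques_powersetCard, cliques_powersetCard, card_powersetCard,
          card_insert_of_notMem hx, kkUpper_full, kkUpper_full (q + 1)]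
    obtain ⟨q, rfl⟩ : ∃ r, q = r + 1 := by
      rcases q with _ | q
      · simp at h1 h2; omega
      · exact ⟨q, rfl⟩
    obtain ⟨m, rfl⟩ := Nat.exists_eq_add_of_lt h1
    have hm' : m + 1 ≤ (#U).choose (q + 1) := by omega
    obtain ⟨B, hB, hB1, hB2, hB3⟩ := ih q (m + 1) hm'
    obtain ⟨W, hW, hW0, rfl⟩ := exists_subfamilies_eq hx
      (Subset.refl (U.powersetCard (q + 1 + 1))) hB
    have h3 : kkUpper (q + 2) ((#U).choose (q + 2) + (m + 1)) =
      (#U).choose (q + 3) + kkUpper (q + 1) (m + 1) := kkUpper_add hm'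
    have h4 : kkUpper (q + 3) ((#U).choose (q + 3) + kkUpper (q + 1) (m + 1)) =
      (#U).choose (q + 4) + kkUpper (q + 2) (kkUpper (q + 1) (m + 1)) :=
        kkUpper_add (q := q + 1) (kkUpper_le_full hm')
    refine ⟨W, hW, ?_, ?_, ?_⟩
    · rw [← card_memberSubfamily_add_card_nonMemberSubfamily x, hW0, hB1, card_powersetCard]
      omega
    · rw [card_cliques_insert hx, hW0, cliques_powersetCard,
        inter_eq_right.2 cliques_subset_powersetCard, hB2, card_powersetCard]
      exact h3.symm
    · rw [card_cliques_cliques_insert hx, hW0, inter_eq_right.2 cliques_subset_powersetCard,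
        cliques_powersetCard, cliques_powersetCard, inter_eq_right.2 cliques_subset_powersetCard,
        hB3, card_powersetCard]
      show _ = kkUpper (q + 3) (kkUpper (q + 2) ((#U).choose (q + 2) + (m + 1)))
      rw [h3, h4]

end cliques

/-! ### The clique bound with its equality clause, and its numerical consequences -/

open Finset in
/-- A family `W` of `q`-sets has at most `kkUpper q #W` cliques; if it has that many, then
the family of its cliques also has the largest possible number of cliques. -/
def HasCliqueBound {α : Type*} [DecidableEq α] (V : Finset α) (q : ℕ) (W : Finset (Finset α)) :
    Prop :=
  #(cliques V q W) ≤ kkUpper q #W ∧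
    (#(cliques V q W) = kkUpper q #W →
      kkUpper (q + 1) (kkUpper q #W) ≤ #(cliques V (q + 1) (cliques V q W)))

/-- Every family of `q`-sets satisfies the clique bounds. -/
def CliqueBound (q : ℕ) : Prop :=
  ∀ ⦃α : Type⦄ [DecidableEq α] (V : Finset α) (W : Finset (Finset α)),
    W ⊆ V.powersetCard q → HasCliqueBound V q W

section bounds

open Finset

/-- A clique has at least three points, so any two of its facets share a point; they cannot lie on
different sides of the disjoint union. -/
theorem cliques_union_subset {α : Type*} [DecidableEq α] {V₁ V₂ : Finset α}
    (hV : Disjoint V₁ V₂) {r : ℕ} {A B : Finset (Finset α)}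
    (hA : A ⊆ V₁.powersetCard (r + 2)) (hB : B ⊆ V₂.powersetCard (r + 2)) :
    cliques (V₁ ∪ V₂) (r + 2) (A ∪ B) ⊆ cliques V₁ (r + 2) A ∪ cliques V₂ (r + 2) B := by
  have key : ∀ {V₁ V₂ : Finset α} {A B : Finset (Finset α)}, Disjoint V₁ V₂ →
      A ⊆ V₁.powersetCard (r + 2) → B ⊆ V₂.powersetCard (r + 2) → ∀ {D : Finset α},
      #D = r + 2 + 1 → (∀ x ∈ D, D.erase x ∈ A ∨ D.erase x ∈ B) →
      ∀ x ∈ D, D.erase x ∈ A → D ∈ cliques V₁ (r + 2) A := by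
    intro V₁ V₂ A B hV hA hB D hD h x hx hxA
    have hall : ∀ y ∈ D, D.erase y ∈ A := by
      intro y hy
      refine (h y hy).resolve_right fun hyB => ?_
      obtain ⟨z, hz⟩ : ((D.erase x).erase y).Nonempty := by
        rw [← card_pos]
        have h1 := pred_card_le_card_erase (s := D.erase x) (a := y)
        rw [card_erase_of_mem hx] at h1
        omega
      rw [mem_erase, mem_erase] at hz
      refine disjoint_left.1 hV ((mem_powersetCard.1 (hA hxA)).1 (mem_erase.2 hz.2))
        ((mem_powersetCard.1 (hB hyB)).1 (mem_erase.2 ⟨hz.1, hz.2.2⟩))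
    refine mem_cliques.2 ⟨⟨fun z hz => ?_, hD⟩, hall⟩
    obtain ⟨y, hy⟩ : (D.erase z).Nonempty := by
      rw [← card_pos, card_erase_of_mem hz]; omega
    rw [mem_erase] at hy
    exact (mem_powersetCard.1 (hA (hall y hy.2))).1 (mem_erase.2 ⟨hy.1.symm, hz⟩)
  intro D hD
  rw [mem_cliques] at hD
  obtain ⟨⟨-, hc⟩, h⟩ := hD
  simp only [mem_union] at h
  obtain ⟨x, hx⟩ : D.Nonempty := card_pos.1 (by omega)
  rcases h x hx with h1 | h1
  · exact mem_union_left _ (key hV hA hB hc h x hx h1)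
  · exact mem_union_right _ (key hV.symm hB hA hc (fun y hy => (h y hy).symm) x hx h1)

/-- Place extremal families of sizes a and b on disjoint ground sets. Their union has at least the
cliques of both parts; in the equality case it has no others, and the equality clause of the clique
bound applies to the union. -/
theorem kkUpper_superadditive {q : ℕ} (hT : CliqueBound (q + 1)) (a b : ℕ) :
    kkUpper (q + 1) a + kkUpper (q + 1) b ≤ kkUpper (q + 1) (a + b) ∧
    (kkUpper (q + 1) a + kkUpper (q + 1) b = kkUpper (q + 1) (a + b) →
      kkUpper (q + 2) (kkUpper (q + 1) (a + b)) ≤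
        kkUpper (q + 2) (kkUpper (q + 1) a) + kkUpper (q + 2) (kkUpper (q + 1) b)) := by
  set N := a + b + q + 1 with hN
  have hbig : a + b < N.choose (q + 1) := lt_choose_add q (a + b)
  obtain ⟨A, hA, hA1, hA2, hA3⟩ := exists_card_cliques_eq (range N) q a
    (by rw [card_range]; omega)
  obtain ⟨B, hB, hB1, hB2, hB3⟩ := exists_card_cliques_eq (Ico N (N + N)) q b
    (by rw [Nat.card_Ico, Nat.add_sub_cancel]; omega)
  have hV : Disjoint (range N) (Ico N (N + N)) := by
    rw [disjoint_left]; intro x; simp only [mem_range, mem_Ico]; omega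
  have hdisj : ∀ {r : ℕ} {A B : Finset (Finset ℕ)}, A ⊆ (range N).powersetCard (r + 1) →
      B ⊆ (Ico N (N + N)).powersetCard (r + 1) → Disjoint A B := by
    intro r A B hA hB
    rw [disjoint_left]
    intro D h1 h2
    have h1 := mem_powersetCard.1 (hA h1)
    have h2 := mem_powersetCard.1 (hB h2)
    obtain ⟨x, hx⟩ : D.Nonempty := card_pos.1 (by omega)
    exact disjoint_left.1 hV (h1.1 hx) (h2.1 hx)
  have hW : A ∪ B ⊆ (range N ∪ Ico N (N + N)).powersetCard (q + 1) :=
    union_subset (hA.trans (powersetCard_mono subset_union_left))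
      (hB.trans (powersetCard_mono subset_union_right))
  have hWc : #(A ∪ B) = a + b := by rw [card_union_of_disjoint (hdisj hA hB), hA1, hB1]
  obtain ⟨h1, h2⟩ := hT _ _ hW
  rw [hWc] at h1 h2
  set V := range N ∪ Ico N (N + N) with hVdef
  set CA := cliques (range N) (q + 1) A with hCA
  set CB := cliques (Ico N (N + N)) (q + 1) B with hCB
  have hsub : CA ∪ CB ⊆ cliques V (q + 1) (A ∪ B) := by
    intro D hD
    rw [mem_cliques]
    rcases mem_union.1 hD with hD | hD <;> rw [mem_cliques] at hD
    · exact ⟨⟨hD.1.1.trans subset_union_left, hD.1.2⟩, fun x hx => mem_union_left _ (hD.2 x hx)⟩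
    · exact ⟨⟨hD.1.1.trans subset_union_right, hD.1.2⟩, fun x hx => mem_union_right _ (hD.2 x hx)⟩
  have hc : #(CA ∪ CB) = kkUpper (q + 1) a + kkUpper (q + 1) b := by
    rw [card_union_of_disjoint (hdisj (r := q + 1) cliques_subset_powersetCard
      cliques_subset_powersetCard), hA2, hB2]
  refine ⟨hc ▸ (card_le_card hsub).trans h1, fun heq => ?_⟩
  have heq' : CA ∪ CB = cliques V (q + 1) (A ∪ B) :=
    eq_of_subset_of_card_le hsub (by rw [hc, heq]; exact h1)
  rw [← heq', hc] at h2
  refine (h2 heq).trans ((card_le_card (cliques_union_subset hV cliques_subset_powersetCard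
    cliques_subset_powersetCard)).trans ((card_union_le _ _).trans ?_))
  rw [hA3, hB3]

/-- Take P outside A and Q in A with |P \ Q| minimal, and exchange one element of Q for one of P:
the result is closer to P, so it cannot lie in A. -/
theorem exists_mem_exists_notMem_erase {α : Type*} [DecidableEq α] {r : ℕ} {V : Finset α}
    {A : Finset (Finset α)} (hA : A ⊆ V.powersetCard r) (hne : A.Nonempty)
    (hlt : #A < (#V).choose r) :
    ∃ D ⊆ V, #D = r + 1 ∧ ∃ x ∈ D, ∃ y ∈ D, D.erase x ∈ A ∧ D.erase y ∉ A := by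
  have hP : (V.powersetCard r \ A).Nonempty := by
    rw [← card_pos, card_sdiff_of_subset hA, card_powersetCard]; omega
  obtain ⟨⟨P, Q⟩, hPQ, hmin⟩ := exists_min_image ((V.powersetCard r \ A) ×ˢ A)
    (fun p => #(p.1 \ p.2)) (hP.product hne)
  simp only [mem_product, mem_sdiff, mem_powersetCard] at hPQ hmin
  obtain ⟨⟨⟨hPV, hPc⟩, hPA⟩, hQA⟩ := hPQ
  obtain ⟨hQV, hQc⟩ := mem_powersetCard.1 (hA hQA)
  have hPQne : P ≠ Q := fun h => hPA (h ▸ hQA)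
  obtain ⟨x, hx⟩ : (P \ Q).Nonempty := by
    rw [sdiff_nonempty]; exact fun h => hPQne (eq_of_subset_of_card_le h (by omega))
  obtain ⟨y, hy⟩ : (Q \ P).Nonempty := by
    rw [sdiff_nonempty]; exact fun h => hPQne (eq_of_subset_of_card_le h (by omega)).symm
  rw [mem_sdiff] at hx hy
  have hxy : x ≠ y := fun h => hx.2 (h ▸ hy.1)
  refine ⟨insert x Q, insert_subset (hPV hx.1) hQV, by rw [card_insert_of_notMem hx.2, hQc],
    x, mem_insert_self _ _, y, mem_insert_of_mem hy.1, by rwa [erase_insert hx.2], fun h => ?_⟩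
  have h1 := hmin (P, (insert x Q).erase y) ⟨⟨⟨hPV, hPc⟩, hPA⟩, h⟩
  have h2 : P \ (insert x Q).erase y ⊂ P \ Q := by
    refine (ssubset_iff_of_subset fun z hz => ?_).2 ⟨x, mem_sdiff.2 hx, fun h => ?_⟩
    · rw [mem_sdiff] at hz ⊢
      refine ⟨hz.1, fun h => hz.2 (mem_erase.2 ⟨fun h' => hy.2 (h' ▸ hz.1), mem_insert_of_mem h⟩)⟩
    · exact (mem_sdiff.1 h).2 (mem_erase.2 ⟨hxy, mem_insert_self _ _⟩)
  exact absurd (card_lt_card h2) (not_lt.2 h1)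

theorem exists_perm_map_eq {α : Type*} [Fintype α] [DecidableEq α] {P Q : Finset α}
    (h : #P = #Q) : ∃ σ : Equiv.Perm α, P.map σ.toEmbedding = Q := by
  obtain ⟨e⟩ : Nonempty ({x // x ∈ P} ≃ {x // x ∈ Q}) :=
    Fintype.card_eq.1 (by simpa using h)
  refine ⟨e.extendSubtype, eq_of_subset_of_card_le ?_ (by rw [card_map, h])⟩
  intro x hx
  obtain ⟨y, hy, rfl⟩ := mem_map.1 hx
  exact e.extendSubtype_mem y hy

theorem card_cliques_map {α : Type*} [Fintype α] [DecidableEq α] (σ : Equiv.Perm α) (q : ℕ)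
    (W : Finset (Finset α)) :
    #(cliques univ q (W.map (mapEmbedding σ.toEmbedding).toEmbedding)) = #(cliques univ q W) := by
  rw [← card_map (mapEmbedding σ.toEmbedding).toEmbedding (s := cliques univ q W)]
  congr 1
  ext D
  obtain ⟨E, rfl⟩ : ∃ E : Finset α, E.map σ.toEmbedding = D :=
    ⟨D.map σ.symm.toEmbedding, by simp [map_map]⟩
  have hmem : ∀ {X : Finset (Finset α)} {E : Finset α}, E.map σ.toEmbedding ∈
      X.map (mapEmbedding σ.toEmbedding).toEmbedding ↔ E ∈ X := by
    intro X E
    exact mem_map' (mapEmbedding σ.toEmbedding).toEmbedding (a := E)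
  rw [hmem]
  simp only [mem_cliques, subset_univ, true_and, card_map]
  refine and_congr_right fun _ => ?_
  simp only [mem_map, forall_exists_index, and_imp, forall_apply_eq_imp_iff₂]
  refine forall₂_congr fun x _ => ?_
  rw [← map_erase, ← hmem (X := W), mem_map]

/-- Clique counts are supermodular: cl(A) + cl(B) ≤ cl(A ∪ B) + cl(A ∩ B). Starting from extremal A
and B, repeated passage to union and intersection fills up all (q+1)-sets of an N-set, and the last
passage loses a clique. -/
theorem kkUpper_add_kkUpper_lt {q : ℕ} (hT : CliqueBound (q + 1)) {N a b : ℕ}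
    (ha : 1 ≤ a) (hab : a ≤ b) (hb : b < N.choose (q + 1)) (hle : N.choose (q + 1) ≤ a + b) :
    kkUpper (q + 1) a + kkUpper (q + 1) b <
      N.choose (q + 2) + kkUpper (q + 1) (a + b - N.choose (q + 1)) := by
  obtain ⟨d, hd⟩ := Nat.exists_eq_add_of_lt hb
  induction d using Nat.strong_induction_on generalizing a b with
  | _ d ih =>
  have hcard : #(univ : Finset (Fin N)) = N := by simp
  obtain ⟨A, hA, hA1, hA2, -⟩ := exists_card_cliques_eq (univ : Finset (Fin N)) q a
    (by rw [hcard]; omega)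
  obtain ⟨B₀, hB₀, hB1, hB2, -⟩ := exists_card_cliques_eq (univ : Finset (Fin N)) q b
    (by rw [hcard]; omega)
  obtain ⟨D, -, hD, x, hx, y, hy, hxA, hyA⟩ := exists_mem_exists_notMem_erase hA
    (card_pos.1 (by omega)) (by rw [hcard]; omega)
  obtain ⟨Q, hQ⟩ : (univ.powersetCard (q + 1) \ B₀).Nonempty := by
    rw [← card_pos, card_sdiff_of_subset hB₀, card_powersetCard, hcard]; omega
  rw [mem_sdiff, mem_powersetCard] at hQ
  -- Moving a set missing from B₀ onto `D.erase x` makes the union strictly larger than B, and keeps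
  -- D from being a clique of A or of B.
  obtain ⟨σ, hσ⟩ := exists_perm_map_eq (P := Q) (Q := D.erase x)
    (by rw [hQ.1.2, card_erase_of_mem hx, hD]; rfl)
  set B := B₀.map (mapEmbedding σ.toEmbedding).toEmbedding with hBdef
  have hBx : D.erase x ∉ B := by
    rw [← hσ]
    intro h
    exact hQ.2 ((mem_map' (mapEmbedding σ.toEmbedding).toEmbedding (a := Q)).1 h)
  have hB : B ⊆ univ.powersetCard (q + 1) := by
    intro E hE
    obtain ⟨E', hE', rfl⟩ := mem_map.1 hE
    have := (mem_powersetCard.1 (hB₀ hE')).2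
    exact mem_powersetCard.2 ⟨subset_univ _, (card_map _).trans this⟩
  have hBc : #B = b := by rw [hBdef, card_map, hB1]
  have hBcl : #(cliques univ (q + 1) B) = kkUpper (q + 1) b := by rw [hBdef, card_cliques_map, hB2]
  have hui := card_union_add_card_inter A B
  have hucl := card_union_add_card_inter (cliques univ (q + 1) A) (cliques univ (q + 1) B)
  have hunion : cliques univ (q + 1) A ∪ cliques univ (q + 1) B ⊆
      cliques univ (q + 1) (A ∪ B) :=
    union_subset (cliques_mono subset_union_left) (cliques_mono subset_union_right)
  have hinter : cliques univ (q + 1) A ∩ cliques univ (q + 1) B ⊆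
      cliques univ (q + 1) (A ∩ B) := by
    intro E hE
    simp only [mem_inter, mem_cliques] at hE ⊢
    exact ⟨hE.1.1, fun z hz => ⟨hE.1.2 z hz, hE.2.2 z hz⟩⟩
  have hi := (card_le_card hinter).trans (hT univ (A ∩ B) (inter_subset_left.trans hA)).1
  have hu := (card_le_card hunion).trans (hT univ (A ∪ B) (union_subset hA hB)).1
  have hlt : b < #(A ∪ B) := by
    rw [← hBc]
    exact card_lt_card ((ssubset_iff_of_subset subset_union_right).2
      ⟨D.erase x, mem_union_left _ hxA, hBx⟩)
  have hmax : #(A ∪ B) ≤ N.choose (q + 1) := by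
    have := card_le_card (union_subset hA hB)
    rwa [card_powersetCard, hcard] at this
  rcases hmax.eq_or_lt with hM | hM
  · have hDn : D ∉ cliques univ (q + 1) A ∪ cliques univ (q + 1) B := by
      rw [mem_union, mem_cliques, mem_cliques]
      rintro (h | h)
      · exact hyA (h.2 y hy)
      · exact hBx (h.2 x hx)
    have h1 : insert D (cliques univ (q + 1) A ∪ cliques univ (q + 1) B) ⊆
        univ.powersetCard (q + 2) :=
      insert_subset (mem_powersetCard.2 ⟨subset_univ _, hD⟩)
        (union_subset cliques_subset_powersetCard cliques_subset_powersetCard)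
    have h2 := card_le_card h1
    rw [card_insert_of_notMem hDn, card_powersetCard, hcard] at h2
    rw [show a + b - N.choose (q + 1) = #(A ∩ B) by omega]
    omega
  · have h3 := ih (N.choose (q + 1) - #(A ∪ B) - 1) (by omega) (a := #(A ∩ B)) (b := #(A ∪ B))
      (by omega) (card_le_card (inter_subset_left.trans subset_union_left)) hM (by omega)
      (by omega)
    rw [show #(A ∩ B) + #(A ∪ B) = a + b by omega] at h3
    omega

end bounds

/-- The numerical form of the clique bounds for a family of `(q + 2)`-sets in which `b` sets avoid
a given point and `a` sets contain it. -/
def CascadeBound (q : ℕ) : Prop :=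
  ∀ a b : ℕ, kkUpper (q + 1) a < b →
    kkUpper (q + 2) b + kkUpper (q + 1) a ≤ kkUpper (q + 2) (a + b) ∧
    (kkUpper (q + 2) b + kkUpper (q + 1) a = kkUpper (q + 2) (a + b) →
      kkUpper (q + 3) (kkUpper (q + 2) (a + b)) ≤
        kkUpper (q + 3) (kkUpper (q + 2) b) + kkUpper (q + 2) (kkUpper (q + 1) a))

theorem kkUpper_kkUpper_add {q n m : ℕ} (h : m ≤ n.choose (q + 1)) :
    kkUpper (q + 3) (kkUpper (q + 2) (n.choose (q + 2) + m)) =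
      n.choose (q + 4) + kkUpper (q + 2) (kkUpper (q + 1) m) := by
  rw [kkUpper_add h]
  exact kkUpper_add (q := q + 1) (kkUpper_le_full h)

/-- Write a + b = C(n, q+2) + m. If b reaches the leading term, removing it leaves superadditivity.
Otherwise b has leading term C(n-1, q+2): for a < C(n-1, q+1) the inequality is strict, and else
both leading terms come off and the bound one level lower applies. -/
theorem cascadeBound_of_cliqueBound {q : ℕ} (hT : CliqueBound (q + 1))
    (ih : ∀ r, q = r + 1 → CascadeBound r) : CascadeBound q := by
  intro a b hab
  obtain ⟨n, m, hm, hmn⟩ := exists_eq_choose_add (q + 1) (a + b)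
  have e0 : (n + 1).choose (q + 2) = n.choose (q + 1) + n.choose (q + 2) :=
    Nat.choose_succ_succ' n (q + 1)
  replace hm : a + b = n.choose (q + 2) + m := hm
  have ha : a < n.choose (q + 1) := by
    by_contra! h
    have h1 := kkUpper_mono (q + 1) h
    rw [kkUpper_full] at h1
    omega
  have hFm := kkUpper_add hmn.le
  have hFFm := kkUpper_kkUpper_add hmn.le
  rw [hm, hFFm, hFm]
  rcases le_or_gt (n.choose (q + 2)) b with hb | hb
  · obtain ⟨b', rfl⟩ := Nat.exists_eq_add_of_le hb
    obtain ⟨h1, h2⟩ := kkUpper_superadditive hT b' a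
    rw [show b' + a = m by omega] at h1 h2
    rw [kkUpper_kkUpper_add (show b' ≤ _ by omega), kkUpper_add (show b' ≤ _ by omega)]
    exact ⟨by omega, fun h => by have := h2 (by omega); omega⟩
  obtain ⟨n, rfl⟩ : ∃ k, n = k + 1 := by
    rcases n with _ | n
    · simp at hmn
    · exact ⟨n, rfl⟩
  have e1 : (n + 1).choose (q + 1) = n.choose q + n.choose (q + 1) := Nat.choose_succ_succ' n q
  have e2 : (n + 1).choose (q + 2) = n.choose (q + 1) + n.choose (q + 2) :=
    Nat.choose_succ_succ' n (q + 1)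
  have e3 : (n + 1).choose (q + 3) = n.choose (q + 2) + n.choose (q + 3) :=
    Nat.choose_succ_succ' n (q + 2)
  have e4 : (n + 1).choose (q + 4) = n.choose (q + 3) + n.choose (q + 4) :=
    Nat.choose_succ_succ' n (q + 3)
  have hb1 : n.choose (q + 2) ≤ b := by
    by_contra! h
    have h1 := kkUpper_mono (q + 1) (show n.choose (q + 1) ≤ a by omega)
    rw [kkUpper_full] at h1
    omega
  obtain ⟨b', rfl⟩ := Nat.exists_eq_add_of_le hb1
  have hb' : b' < n.choose (q + 1) := by omega
  rw [kkUpper_kkUpper_add hb'.le, kkUpper_add hb'.le]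
  rcases lt_or_ge a (n.choose (q + 1)) with ha1 | ha1
  · suffices h : kkUpper (q + 1) a + kkUpper (q + 1) b' < n.choose (q + 2) + kkUpper (q + 1) m by
      exact ⟨by omega, fun h => by omega⟩
    rcases le_total a b' with h | h
    · have := kkUpper_add_kkUpper_lt hT (N := n) (a := a) (b := b') (by omega) h hb' (by omega)
      rwa [show a + b' - n.choose (q + 1) = m by omega] at this
    · have := kkUpper_add_kkUpper_lt hT (N := n) (a := b') (b := a) (by omega) h ha1 (by omega)
      rw [show b' + a - n.choose (q + 1) = m by omega] at this
      omega
  obtain ⟨a', rfl⟩ := Nat.exists_eq_add_of_le ha1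
  have ha' : a' < n.choose q := by omega
  obtain rfl : a' + b' = m := by omega
  rcases q with _ | q
  · obtain rfl : a' = 0 := by simpa using ha'
    simp only [zero_add, add_zero] at *
    rw [kkUpper_full 0, kkUpper_full 1]
    simp only [Nat.reduceAdd, zero_add] at *
    exact ⟨by omega, fun _ => by omega⟩
  · have h1 : kkUpper (q + 2) (n.choose (q + 2) + a') = n.choose (q + 3) + kkUpper (q + 1) a' :=
      kkUpper_add ha'.le
    have h2 : kkUpper (q + 3) (kkUpper (q + 2) (n.choose (q + 2) + a')) =
      n.choose (q + 4) + kkUpper (q + 2) (kkUpper (q + 1) a') := kkUpper_kkUpper_add ha'.le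
    simp only [Nat.add_assoc, Nat.reduceAdd] at *
    rw [h1] at hab
    obtain ⟨h3, h4⟩ := ih q rfl a' b' (by omega)
    rw [h1, ← h1, h2, h1]
    exact ⟨by omega, fun h => by have := h4 (by omega); omega⟩

/-! ### Induction on the ground set for the clique bound -/

section bounds

open Finset

variable {α : Type*} [DecidableEq α] {U : Finset α} {q : ℕ} {W : Finset (Finset α)} {x : α}

/-- The cliques through x are bounded by the members avoiding x. Equality puts all these members
among the cliques of the link, so the second clique count is that of a cone and `kkUpper_cone`
applies. -/
theorem HasCliqueBound.insert_of_le (hx : x ∉ U)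
    (h0 : HasCliqueBound U (q + 1) (W.nonMemberSubfamily x))
    (h : kkUpper (q + 1) #(W.nonMemberSubfamily x) + #(W.nonMemberSubfamily x) ≤
      kkUpper (q + 1) (#(W.memberSubfamily x) + #(W.nonMemberSubfamily x))) :
    HasCliqueBound (insert x U) (q + 1) W := by
  obtain ⟨h1, h2⟩ := h0
  have hi : #(W.nonMemberSubfamily x ∩ cliques U q (W.memberSubfamily x)) ≤
    #(W.nonMemberSubfamily x) := card_le_card inter_subset_left
  have hc := card_cliques_insert (q := q) (W := W) hx
  unfold HasCliqueBound
  rw [← card_memberSubfamily_add_card_nonMemberSubfamily x W]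
  refine ⟨by omega, fun heq => ?_⟩
  have hi' := eq_of_subset_of_card_le (inter_subset_left (s₁ := W.nonMemberSubfamily x)
    (s₂ := cliques U q (W.memberSubfamily x))) (by omega)
  rw [card_cliques_cliques_insert hx, hi', inter_self]
  have h3 := h2 (by omega)
  rw [hi'] at hc
  rw [← heq, show #(cliques (insert x U) (q + 1) W) = #(W.nonMemberSubfamily x) +
    kkUpper (q + 1) #(W.nonMemberSubfamily x) by omega]
  refine (kkUpper_cone q _).trans ?_
  have h4 : #(cliques U (q + 1) (W.nonMemberSubfamily x)) =
    kkUpper (q + 1) #(W.nonMemberSubfamily x) := by omega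
  have h5 : kkUpper (q + 2) (kkUpper (q + 1) #(W.nonMemberSubfamily x)) ≤
    #(cliques U (q + 2) (cliques U (q + 1) (W.nonMemberSubfamily x))) := h3
  omega

/-- Here the cliques through x are bounded by the cliques of the link. Equality makes the link, the
members avoiding x and the numerical bound all tight, and the three equality clauses add up. -/
theorem HasCliqueBound.insert_of_lt (hx : x ∉ U)
    (h0 : HasCliqueBound U (q + 2) (W.nonMemberSubfamily x))
    (h1 : HasCliqueBound U (q + 1) (W.memberSubfamily x)) (hN : CascadeBound q)
    (h : kkUpper (q + 1) #(W.memberSubfamily x) < #(W.nonMemberSubfamily x)) :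
    HasCliqueBound (insert x U) (q + 2) W := by
  obtain ⟨h2, h3⟩ := h0
  obtain ⟨h4, h5⟩ := h1
  obtain ⟨h6, h7⟩ := hN _ _ h
  have hi : #(W.nonMemberSubfamily x ∩ cliques U (q + 1) (W.memberSubfamily x)) ≤
    #(cliques U (q + 1) (W.memberSubfamily x)) := card_le_card inter_subset_right
  have hc := card_cliques_insert (q := q + 1) (W := W) hx
  replace hc : #(cliques (insert x U) (q + 2) W) =
      #(cliques U (q + 2) (W.nonMemberSubfamily x)) +
        #(W.nonMemberSubfamily x ∩ cliques U (q + 1) (W.memberSubfamily x)) := hc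
  unfold HasCliqueBound
  rw [← card_memberSubfamily_add_card_nonMemberSubfamily x W]
  refine ⟨by omega, fun heq => ?_⟩
  have hi' := eq_of_subset_of_card_le (inter_subset_right (s₁ := W.nonMemberSubfamily x)
    (s₂ := cliques U (q + 1) (W.memberSubfamily x))) (by omega)
  have hc2 := card_cliques_cliques_insert (q := q + 1) (W := W) hx
  rw [hi', inter_eq_right.2 (cliques_mono (inter_eq_right.1 hi'))] at hc2
  have h8 := h3 (by omega)
  have h9 := h5 (by omega)
  have h10 := h7 (by omega)
  simp only [Nat.add_assoc, Nat.reduceAdd] at *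
  omega

theorem cliqueBound_one : CliqueBound 1 := by
  intro α _ V
  induction V using Finset.induction_on with
  | empty =>
    intro W hW
    obtain rfl : W = ∅ := by
      rwa [powersetCard_eq_empty.2 (by simp), subset_empty] at hW
    exact ⟨by simp, fun _ => by simp⟩
  | insert x U hx ih =>
    intro W hW
    have h0 := ih _ (nonMemberSubfamily_subset_powersetCard hW)
    have h1 := card_le_card (memberSubfamily_subset_powersetCard (q := 0) hW)
    rw [card_powersetCard, Nat.choose_zero_right] at h1
    rcases h1.eq_or_lt with h2 | h2
    · refine HasCliqueBound.insert_of_le (q := 0) hx h0 ?_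
      rw [h2, zero_add, kkUpper_one, kkUpper_one, add_comm 1]
      have : (#(W.nonMemberSubfamily x) + 1).choose 2 = (#(W.nonMemberSubfamily x)).choose 1 +
        (#(W.nonMemberSubfamily x)).choose 2 := Nat.choose_succ_succ' _ 1
      rw [Nat.choose_one_right] at this
      omega
    · have h3 : W.memberSubfamily x = ∅ := card_eq_zero.1 (by omega)
      unfold HasCliqueBound
      rw [← card_memberSubfamily_add_card_nonMemberSubfamily x W, card_cliques_insert (q := 0) hx,
        card_cliques_cliques_insert (q := 0) hx, h3]
      simpa [HasCliqueBound] using h0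

theorem cliqueBound_succ {q : ℕ} (hT : CliqueBound (q + 1)) (hN : CascadeBound q) :
    CliqueBound (q + 2) := by
  intro α _ V
  induction V using Finset.induction_on with
  | empty =>
    intro W hW
    obtain rfl : W = ∅ := by
      rwa [powersetCard_eq_empty.2 (by simp), subset_empty] at hW
    exact ⟨by simp, fun _ => by simp⟩
  | insert x U hx ih =>
    intro W hW
    have h0 := ih _ (nonMemberSubfamily_subset_powersetCard hW)
    rcases le_or_gt #(W.nonMemberSubfamily x) (kkUpper (q + 1) #(W.memberSubfamily x)) with h | h
    · exact HasCliqueBound.insert_of_le (q := q + 1) hx h0 (kkUpper_add_self_le h)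
    · exact HasCliqueBound.insert_of_lt hx h0
        (hT U _ (memberSubfamily_subset_powersetCard hW)) hN h

theorem cliqueBound_and_cascadeBound (q : ℕ) : CliqueBound (q + 1) ∧ CascadeBound q := by
  induction q with
  | zero =>
    exact ⟨cliqueBound_one, cascadeBound_of_cliqueBound cliqueBound_one fun r hr => by omega⟩
  | succ q ih =>
    have h := cliqueBound_succ ih.1 ih.2
    refine ⟨h, cascadeBound_of_cliqueBound h fun r hr => ?_⟩
    obtain rfl : q = r := by omega
    exact ih.2

theorem cliqueBound {q : ℕ} (hq : 0 < q) : CliqueBound q := by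
  obtain ⟨q, rfl⟩ : ∃ r, q = r + 1 := ⟨q - 1, by omega⟩
  exact (cliqueBound_and_cascadeBound q).1

end bounds

/-! ### Complementation: from cliques to shadows -/

section duality

open Finset

variable {α : Type} [Fintype α] [DecidableEq α] {k : ℕ} {S : Finset (Finset α)}

theorem shadow_subset_powersetCard (hS : S ⊆ univ.powersetCard (k + 1)) :
    S.shadow ⊆ univ.powersetCard k := by
  intro D hD
  obtain ⟨E, hE, x, hx, rfl⟩ := mem_shadow_iff.1 hD
  have := (mem_powersetCard.1 (hS hE)).2
  exact mem_powersetCard.2 ⟨subset_univ _, by rw [card_erase_of_mem hx, this]; rfl⟩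

/-- The clique form of the Kruskal–Katona theorem. -/
theorem card_le_kkUpper_card_shadow (hk : 0 < k) (hS : S ⊆ univ.powersetCard (k + 1)) :
    #S ≤ kkUpper k #S.shadow := by
  refine (card_le_card fun D hD => ?_).trans
    (cliqueBound hk univ S.shadow (shadow_subset_powersetCard hS)).1
  exact mem_cliques.2 ⟨⟨subset_univ _, (mem_powersetCard.1 (hS hD)).2⟩,
    fun x hx => erase_mem_shadow hD hx⟩

theorem shadow_cliques_subset (W : Finset (Finset α)) : (cliques univ k W).shadow ⊆ W := by
  intro D hD
  obtain ⟨E, hE, x, hx, rfl⟩ := mem_shadow_iff.1 hD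
  exact (mem_cliques.1 hE).2 x hx

/-- The complements of the `k`-sets that do not belong to `S`. -/
def complFamily (k : ℕ) (S : Finset (Finset α)) : Finset (Finset α) :=
  (univ.powersetCard (Fintype.card α - k)).filter fun D => Dᶜ ∉ S

theorem complFamily_subset : complFamily k S ⊆ univ.powersetCard (Fintype.card α - k) :=
  filter_subset _ _

theorem complFamily_complFamily (hk : k ≤ Fintype.card α) (hS : S ⊆ univ.powersetCard k) :
    complFamily (Fintype.card α - k) (complFamily k S) = S := by
  ext D
  simp only [complFamily, mem_filter, mem_powersetCard, subset_univ, true_and, compl_compl,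
    card_compl, not_and, not_not]
  constructor
  · rintro ⟨h1, h2⟩
    exact h2 (by omega)
  · intro h
    have := (mem_powersetCard.1 (hS h)).2
    exact ⟨by omega, fun _ => h⟩

theorem card_complFamily (hk : k ≤ Fintype.card α) (hS : S ⊆ univ.powersetCard k) :
    #(complFamily k S) + #S = (Fintype.card α).choose k := by
  rw [← card_univ (α := α), ← card_powersetCard, ← card_sdiff_add_card_eq_card hS]
  congr 1
  refine card_bij (fun D _ => Dᶜ) ?_ (fun _ _ _ _ h => compl_injective h) ?_
  · intro D hD
    simp only [complFamily, mem_filter, mem_powersetCard, subset_univ, true_and, mem_sdiff,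
      card_compl] at hD ⊢
    exact ⟨by omega, hD.2⟩
  · intro D hD
    simp only [complFamily, mem_filter, mem_powersetCard, subset_univ, true_and, mem_sdiff] at hD ⊢
    exact ⟨Dᶜ, ⟨by rw [card_compl, hD.1], by simpa using hD.2⟩, compl_compl _⟩

/-- Deleting a point from D adds it to Dᶜ, so D is a clique exactly when no one-point extension of
Dᶜ lies in S. -/
theorem cliques_complFamily (hk : k + 1 ≤ Fintype.card α) :
    cliques univ (Fintype.card α - (k + 1)) (complFamily (k + 1) S) =
      complFamily k S.shadow := by
  ext D
  simp only [complFamily, mem_filter, mem_powersetCard, subset_univ, true_and, mem_cliques,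
    mem_shadow_iff_insert_mem, not_exists, not_and, mem_compl, not_not, compl_erase]
  constructor
  · rintro ⟨h1, h2⟩
    exact ⟨by omega, fun x hx => (h2 x hx).2⟩
  · rintro ⟨h1, h2⟩
    exact ⟨by omega, fun x hx => ⟨by rw [card_erase_of_mem hx]; omega, h2 x hx⟩⟩

/-- The shadow of `S` is as small as possible among families of `k`-sets with `#S` members. -/
def HasMinimalShadow (k : ℕ) (S : Finset (Finset α)) : Prop :=
  ∀ S' : Finset (Finset α), S' ⊆ univ.powersetCard k → #S' = #S → #S.shadow ≤ #S'.shadow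

/-- If a family has the smallest possible shadow, so does its shadow. -/
theorem HasMinimalShadow.shadow (hS : S ⊆ univ.powersetCard (k + 2))
    (h : HasMinimalShadow (k + 2) S) : HasMinimalShadow (k + 1) S.shadow := by
  intro S' hS' hcard
  have hsh := shadow_subset_powersetCard hS
  rcases S.eq_empty_or_nonempty with rfl | ⟨D, hD⟩
  · simp
  have hkn : k + 2 ≤ Fintype.card α := by
    rw [← (mem_powersetCard.1 (hS hD)).2]; exact card_le_univ D
  -- If k + 2 is the size of the ground set, the complements are empty and the clique bound is
  -- unavailable; S is then the whole set alone and its shadow is everything.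
  rcases hkn.eq_or_lt with hkn | hkn
  · suffices S.shadow = univ.powersetCard (k + 1) by
      have h1 : S' = univ.powersetCard (k + 1) :=
        eq_of_subset_of_card_le hS' (by rw [hcard, this])
      rw [this, h1]
    refine hsh.antisymm fun E hE => ?_
    have hDu : D = univ := (card_eq_iff_eq_univ D).1 ((mem_powersetCard.1 (hS hD)).2.trans hkn)
    have hEc := (mem_powersetCard.1 hE).2
    rw [mem_shadow_iff_exists_mem_card_add_one]
    exact ⟨D, hD, hDu ▸ subset_univ _, by rw [(mem_powersetCard.1 (hS hD)).2, hEc]⟩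
  obtain ⟨q, hq⟩ : ∃ q, Fintype.card α = k + 2 + (q + 1) :=
    ⟨Fintype.card α - (k + 2) - 1, by omega⟩
  have e2 : Fintype.card α - (k + 2) = q + 1 := by omega
  have e1 : Fintype.card α - (k + 1) = q + 2 := by omega
  have hW : complFamily (k + 2) S ⊆ univ.powersetCard (q + 1) := e2 ▸ complFamily_subset
  have hcl : cliques univ (q + 1) (complFamily (k + 2) S) = complFamily (k + 1) S.shadow :=
    e2 ▸ cliques_complFamily (k := k + 1) (by omega)
  have hcl' : ∀ T : Finset (Finset α), cliques univ (q + 2) (complFamily (k + 1) T) =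
      complFamily k T.shadow := fun T => e1 ▸ cliques_complFamily (k := k) (by omega)
  obtain ⟨h1, h2⟩ := cliqueBound (show 0 < q + 1 by omega) univ _ hW
  have hWc := card_complFamily (show k + 2 ≤ Fintype.card α by omega) hS
  -- The dual of this extremal family competes with S: minimality of the shadow of S forces the dual
  -- of S to attain the clique bound, which triggers the equality clause `h2`.
  obtain ⟨W', hW', hW'c, hW'cl, -⟩ := exists_card_cliques_eq (univ : Finset α) q
    #(complFamily (k + 2) S) (by simpa using card_le_card hW)
  have hT := complFamily_subset (k := q + 1) (S := W')
  rw [show Fintype.card α - (q + 1) = k + 2 by omega] at hT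
  have hTW : complFamily (k + 2) (complFamily (q + 1) W') = W' := by
    have := complFamily_complFamily (show q + 1 ≤ Fintype.card α by omega) hW'
    rwa [show Fintype.card α - (q + 1) = k + 2 by omega] at this
  have hTc := card_complFamily (show k + 2 ≤ Fintype.card α by omega) hT
  rw [hTW] at hTc
  have hTcl : cliques univ (q + 1) W' = complFamily (k + 1) (complFamily (q + 1) W').shadow := by
    have := cliques_complFamily (k := k + 1) (S := complFamily (q + 1) W') (by omega)
    rw [show k + 1 + 1 = k + 2 from rfl, e2, hTW] at this
    exact this
  have h3 := h _ hT (by omega)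
  have h4 := card_complFamily (show k + 1 ≤ Fintype.card α by omega) hsh
  have h5 := card_complFamily (show k + 1 ≤ Fintype.card α by omega)
    (shadow_subset_powersetCard hT)
  rw [hTcl] at hW'cl
  rw [hcl] at h1 h2
  have h6 := h2 (by omega)
  have h7 : #(complFamily (k + 1) S.shadow) = kkUpper (q + 1) #(complFamily (k + 2) S) := by
    omega
  have h8 : #(complFamily (k + 1) S') = #(complFamily (k + 1) S.shadow) := by
    have := card_complFamily (show k + 1 ≤ Fintype.card α by omega) hS'
    omega
  have h9 := (cliqueBound (show 0 < q + 2 by omega) univ (complFamily (k + 1) S')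
    (e1 ▸ complFamily_subset)).1
  rw [hcl', h8, h7] at h9
  have h10 : kkUpper (q + 2) (kkUpper (q + 1) #(complFamily (k + 2) S)) ≤
      #(complFamily k S.shadow.shadow) := by rw [← hcl']; exact h6
  have h11 := card_complFamily (show k ≤ Fintype.card α by omega)
    (shadow_subset_powersetCard hsh)
  have h12 := card_complFamily (show k ≤ Fintype.card α by omega)
    (shadow_subset_powersetCard hS')
  omega

end duality

/-! ### Cascades, and cascades plus one -/

section cascades

open Finset

theorem cascade_lt {r : ℕ} {b : ℕ → ℕ} (hb : ∀ j, j + 1 < r → b (j + 1) < b j) :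
    ∑ j ∈ range r, (b j).choose (r - j) < (b 0 + 1).choose r := by
  induction r generalizing b with
  | zero => simp
  | succ r ih =>
    rw [sum_range_succ', Nat.choose_succ_succ', Nat.sub_zero]
    refine Nat.add_lt_add_right ?_ _
    simp only [Nat.add_sub_add_right]
    rcases r with _ | r
    · simp
    · exact (ih (b := fun j => b (j + 1)) fun j hj => hb (j + 1) (by omega)).trans_le
        (Nat.choose_le_choose _ (hb 0 (by omega)))

theorem cascade_le {r p : ℕ} (hp : p ≤ r + 1) {b : ℕ → ℕ}
    (hb : ∀ j, j + 1 < p → b (j + 1) < b j) :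
    ∑ j ∈ range p, (b j).choose (r - j) ≤ (b 0 + 1).choose r := by
  induction r generalizing b p with
  | zero =>
    interval_cases p <;> simp
  | succ r ih =>
    rcases p with _ | p
    · simp
    rw [sum_range_succ', Nat.choose_succ_succ', Nat.sub_zero]
    refine Nat.add_le_add_right ?_ _
    simp only [Nat.add_sub_add_right]
    rcases p with _ | p
    · simp
    · exact (ih (p := p + 1) (by omega) (b := fun j => b (j + 1))
        fun j hj => hb (j + 1) (by omega)).trans (Nat.choose_le_choose _ (hb 0 (by omega)))

theorem cascade_tail_le {r p : ℕ} (hp : p ≤ r + 1) {b : ℕ → ℕ}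
    (hb : ∀ j, j + 1 < p + 1 → b (j + 1) < b j) :
    ∑ j ∈ range p, (b (j + 1)).choose (r - j) ≤ (b 0).choose r := by
  rcases p with _ | p
  · simp
  · exact (cascade_le (b := fun j => b (j + 1)) hp fun j hj => hb (j + 1) (by omega)).trans
      (Nat.choose_le_choose _ (hb 0 (by omega)))

theorem cascade_succ (b : ℕ → ℕ) (r p : ℕ) :
    ∑ j ∈ range (p + 1), (b j).choose (r + 1 - j) =
      (b 0).choose (r + 1) + ∑ j ∈ range p, (b (j + 1)).choose (r - j) := by
  rw [sum_range_succ', add_comm]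
  simp only [Nat.add_sub_add_right, Nat.sub_zero]

theorem kkUpper_cascade {r p : ℕ} (hp : p ≤ r + 1) {b : ℕ → ℕ}
    (hb : ∀ j, j + 1 < p → b (j + 1) < b j) :
    kkUpper (r + 1) (∑ j ∈ range p, (b j).choose (r + 1 - j)) =
      ∑ j ∈ range p, (b j).choose (r + 2 - j) := by
  induction r generalizing b p with
  | zero =>
    interval_cases p <;> simp [kkUpper_one]
  | succ r ih =>
    rcases p with _ | p
    · simp
    have h1 : ∑ j ∈ range p, (b (j + 1)).choose (r + 1 - j) ≤ (b 0).choose (r + 1) :=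
      cascade_tail_le (by omega) hb
    rw [cascade_succ b (r + 1), cascade_succ b (r + 2),
      ← ih (b := fun j => b (j + 1)) (by omega) fun j hj => hb (j + 1) (by omega)]
    exact kkUpper_add h1

/-- Peeling off leading terms carries the extra 1 down to the linear term, where C(b + 1, 2) = C(b,
2) + b. -/
theorem kkUpper_cascade_add_one {r : ℕ} {b : ℕ → ℕ}
    (hb : ∀ j, j + 1 < r + 1 → b (j + 1) < b j) :
    kkUpper (r + 1) (∑ j ∈ range (r + 1), (b j).choose (r + 1 - j) + 1) =
      ∑ j ∈ range (r + 1), (b j).choose (r + 2 - j) + b r := by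
  induction r generalizing b with
  | zero =>
    have : (b 0 + 1).choose 2 = (b 0).choose 1 + (b 0).choose 2 := Nat.choose_succ_succ' _ 1
    rw [Nat.choose_one_right] at this
    simp [kkUpper_one, this, add_comm]
  | succ r ih =>
    have h1 : ∑ j ∈ range (r + 1), (b (j + 1)).choose (r + 1 - j) + 1 ≤ (b 0).choose (r + 1) :=
      Nat.succ_le_of_lt ((cascade_lt (r := r + 1) (b := fun j => b (j + 1))
        fun j hj => hb (j + 1) (by omega)).trans_le (Nat.choose_le_choose _ (hb 0 (by omega))))
    have h2 := ih (b := fun j => b (j + 1)) fun j hj => hb (j + 1) (by omega)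
    rw [cascade_succ b (r + 1), cascade_succ b (r + 2), add_assoc ((b 0).choose _),
      add_assoc ((b 0).choose _)]
    exact (kkUpper_add h1).trans (congrArg _ h2)

/-- Strictness comes from the last term on the right, which is positive because r + 2 - t ≤ b t. -/
theorem kkUpper_lt_cascade {r t y : ℕ} (ht : t ≤ r + 1) {b : ℕ → ℕ}
    (hb : ∀ j, j + 1 < t + 1 → b (j + 1) < b j) (hbt : r + 2 - t ≤ b t)
    (hy : y < ∑ j ∈ range (t + 1), (b j).choose (r + 1 - j)) :
    kkUpper (r + 1) y < ∑ j ∈ range (t + 1), (b j).choose (r + 2 - j) := by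
  induction r generalizing b t y with
  | zero =>
    rcases t with _ | t
    · simpa using kkUpper_lt_full (q := 0) hbt (by simpa using hy)
    · obtain rfl : t = 0 := by omega
      simp [sum_range_succ, kkUpper_one] at hy hbt ⊢
      have := Nat.choose_le_choose 2 (show y ≤ b 0 by omega)
      omega
  | succ r ih =>
    rcases t with _ | t
    · simp only [zero_add, range_one, sum_singleton, Nat.sub_zero] at hy ⊢
      exact kkUpper_lt_full hbt hy
    rw [cascade_succ b (r + 1) (t + 1)] at hy
    rw [cascade_succ b (r + 2) (t + 1)]
    replace hy : y < (b 0).choose (r + 2) + _ := hy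
    show kkUpper (r + 2) y < (b 0).choose (r + 3) + _
    rcases le_or_gt y ((b 0).choose (r + 2)) with h | h
    · refine (kkUpper_le_full (q := r + 1) h).trans_lt (Nat.lt_add_of_pos_right ?_)
      refine lt_of_lt_of_le (Nat.choose_pos (show r + 2 - t ≤ b (t + 1) by omega)) ?_
      exact single_le_sum (f := fun j => (b (j + 1)).choose (r + 2 - j))
        (fun _ _ => Nat.zero_le _) (self_mem_range_succ t)
    · obtain ⟨y, rfl⟩ := Nat.exists_eq_add_of_lt h
      have h1 : ∑ j ∈ range (t + 1), (b (j + 1)).choose (r + 1 - j) ≤ (b 0).choose (r + 1) :=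
        cascade_tail_le (by omega) hb
      have h2 : y + 1 < ∑ j ∈ range (t + 1), (b (j + 1)).choose (r + 1 - j) := by omega
      have h3 : kkUpper (r + 2) ((b 0).choose (r + 2) + (y + 1)) =
        (b 0).choose (r + 3) + kkUpper (r + 1) (y + 1) := kkUpper_add (by omega)
      have h4 := ih (b := fun j => b (j + 1)) (t := t) (by omega)
        (fun j hj => hb (j + 1) (by omega)) (by omega) h2
      exact h3.trans_lt (Nat.add_lt_add_left h4 _)

/-- Normalizing `1` plus a cascade to a cascade. -/
theorem exists_cascade_eq_add_one {r : ℕ} {b : ℕ → ℕ}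
    (hb : ∀ j, j + 1 < r + 1 → b (j + 1) < b j) :
    ∃ (t : ℕ) (a : ℕ → ℕ), t < r + 1 ∧ (∀ j, j + 1 < t + 1 → a (j + 1) < a j) ∧
      r + 1 - t ≤ a t ∧
      ∑ j ∈ range (r + 1), (b j).choose (r + 1 - j) + 1 =
        ∑ j ∈ range (t + 1), (a j).choose (r + 1 - j) ∧
      ∑ j ∈ range r, (b j).choose (r - j) + 1 = ∑ j ∈ range (t + 1), (a j).choose (r - j) ∧
      (a 0 = b 0 ∨ t = 0 ∧ a 0 = b 0 + 1) := by
  induction r generalizing b with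
  | zero => exact ⟨0, fun _ => b 0 + 1, by simp⟩
  | succ r ih =>
    obtain ⟨t, a, h1, h2, h3, h4, h5, h6⟩ := ih (b := fun j => b (j + 1))
      fun j hj => hb (j + 1) (by omega)
    have hb0 : b 1 < b 0 := hb 0 (by omega)
    simp only [zero_add] at h6
    rw [cascade_succ b (r + 1), cascade_succ b r, add_assoc ((b 0).choose _),
      add_assoc ((b 0).choose _), h4, h5]
    -- In a collision the normalized tail is a single term, which Pascal's rule absorbs into the
    -- leading one.
    by_cases h7 : a 0 = b 0
    · rcases h6 with h6 | ⟨rfl, h6⟩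
      · omega
      refine ⟨0, fun _ => b 0 + 1, by omega, by simp, by simp; omega, ?_, ?_, by simp⟩
      · simp only [Nat.sub_zero, zero_add, range_one, sum_singleton]
        rw [h7, Nat.choose_succ_succ', add_comm]
      · simp only [Nat.sub_zero, zero_add, range_one, sum_singleton]
        rw [h7, Nat.choose_succ_succ', add_comm]
    · have h8 : a 0 < b 0 := by omega
      refine ⟨t + 1, fun i => Nat.casesOn i (b 0) a, by omega, ?_, by simpa using h3, ?_, ?_,
        Or.inl rfl⟩
      · rintro (_ | j) hj
        · exact h8
        · exact h2 j (by omega)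
      · exact (cascade_succ (fun i => Nat.casesOn i (b 0) a) (r + 1) (t + 1)).symm
      · exact (cascade_succ (fun i => Nat.casesOn i (b 0) a) r (t + 1)).symm

end cascades

/-! ### Sign argument for generating series -/

section series

open Finset PowerSeries

/-- The coefficients 1 and -d of P contribute C(d, s+1) - d C(d, s) ≤ 0; all other contributions are
nonpositive termwise. -/
theorem coeff_mul_one_add_pow_nonpos {P : PowerSeries ℤ} {d : ℕ} (h0 : coeff 0 P = 1)
    (h1 : coeff 1 P = -d) (h : ∀ s, coeff (s + 1) P ≤ 0) (s : ℕ) :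
    coeff (s + 1) (P * PowerSeries.binomialSeries ℤ (d : ℤ)) ≤ 0 := by
  rw [coeff_mul, Finset.Nat.sum_antidiagonal_eq_sum_range_succ_mk]
  simp only [binomialSeries_coeff, Ring.choose_natCast, smul_eq_mul, mul_one]
  rw [sum_range_succ', sum_range_succ', h0, zero_add, h1]
  have h2 : ∑ k ∈ range s, coeff (k + 1 + 1) P * ((d.choose (s + 1 - (k + 1 + 1)) : ℕ) : ℤ) ≤ 0 :=
    sum_nonpos fun k _ => mul_nonpos_of_nonpos_of_nonneg (h (k + 1)) (Int.natCast_nonneg _)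
  have h3 : d.choose (s + 1) ≤ d * d.choose s := by
    have h4 := Nat.choose_succ_right_eq d s
    calc d.choose (s + 1) ≤ d.choose (s + 1) * (s + 1) := Nat.le_mul_of_pos_right _ (by omega)
      _ = d.choose s * (d - s) := h4
      _ ≤ d.choose s * d := Nat.mul_le_mul_left _ (Nat.sub_le _ _)
      _ = _ := mul_comm _ _
  have h5 : ((d.choose (s + 1) : ℕ) : ℤ) ≤ d * (d.choose s : ℕ) := by exact_mod_cast h3
  simp only [Nat.add_sub_cancel, Nat.sub_zero, one_mul, neg_mul]
  linarith

/-- The series `∑ i, x ^ i (1 + x) ^ (β i)`. -/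
noncomputable def cascadeSeries (β : ℕ → ℤ) : PowerSeries ℤ :=
  mk fun s => ∑ i ∈ range (s + 1), Ring.choose (β i) (s - i)

theorem cascadeSeries_eq (β : ℕ → ℤ) :
    cascadeSeries β = PowerSeries.binomialSeries ℤ (β 0) + X * cascadeSeries fun i => β (i + 1) := by
  ext s
  rcases s with _ | s
  · simp [cascadeSeries]
  · rw [map_add, coeff_succ_X_mul, binomialSeries_coeff, cascadeSeries, cascadeSeries, coeff_mk,
      coeff_mk, sum_range_succ', add_comm]
    simp

/-- The linear coefficient β 0 + 1 + c is nonpositive; call it -d. Multiplying by (1+x)^d keeps the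
signs, and a further factor 1 + x normalizes the leading summand to 1. Removing it leaves x times
the shifted series, now with exponent -β 0. -/
theorem cascadeSeries_step {β : ℕ → ℤ} {c : ℤ}
    (h : ∀ s, coeff (s + 1) (cascadeSeries β * PowerSeries.binomialSeries ℤ c) ≤ 0) :
    β 0 < -c ∧ ∀ s, coeff (s + 1) ((cascadeSeries fun i => β (i + 1)) *
      PowerSeries.binomialSeries ℤ (-β 0)) ≤ 0 := by
  set P := cascadeSeries β * PowerSeries.binomialSeries ℤ c with hP
  have h0 : coeff 0 P = 1 := by simp [hP, coeff_mul, cascadeSeries]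
  have h1 : coeff 1 P = β 0 + 1 + c := by
    rw [hP, coeff_mul, Finset.Nat.sum_antidiagonal_eq_sum_range_succ_mk]
    simp [cascadeSeries, sum_range_succ]
    ring
  have hle := h 0
  rw [zero_add, h1] at hle
  refine ⟨by omega, fun s => ?_⟩
  obtain ⟨d, hd⟩ := Int.eq_ofNat_of_zero_le (show 0 ≤ -(β 0 + 1 + c) by omega)
  have hR := coeff_mul_one_add_pow_nonpos (P := P) (d := d) h0 (by rw [h1]; omega) h
  have key : X * ((cascadeSeries fun i => β (i + 1)) * PowerSeries.binomialSeries ℤ (-β 0)) =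
      P * PowerSeries.binomialSeries ℤ (d : ℤ) * (1 + X) - 1 := by
    have e1 : PowerSeries.binomialSeries ℤ (-β 0) = PowerSeries.binomialSeries ℤ c * PowerSeries.binomialSeries ℤ (d : ℤ) * (1 + X) := by
      have e2 : (1 + X : PowerSeries ℤ) = PowerSeries.binomialSeries ℤ ((1 : ℕ) : ℤ) := by
        rw [binomialSeries_nat, pow_one]
      rw [e2, ← binomialSeries_add, ← binomialSeries_add]
      congr 1
      push_cast
      omega
    have e3 : PowerSeries.binomialSeries ℤ (β 0) * PowerSeries.binomialSeries ℤ (-β 0) = 1 := by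
      rw [← binomialSeries_add, add_neg_cancel, binomialSeries_zero]
    have e4 : X * (cascadeSeries fun i => β (i + 1)) =
        cascadeSeries β - PowerSeries.binomialSeries ℤ (β 0) := by
      rw [cascadeSeries_eq β]; ring
    rw [← mul_assoc, e4, sub_mul, e3, e1, hP]
    ring
  have h2 := congrArg (coeff (s + 2)) key
  rw [coeff_succ_X_mul, mul_add, mul_one, map_sub, map_add, coeff_succ_mul_X] at h2
  have h3 := hR s
  have h4 := hR (s + 1)
  rw [h2, coeff_one, if_neg (by omega)]
  linarith

theorem strictAnti_of_cascade_nonpos {β : ℕ → ℤ}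
    (h : ∀ s, ∑ i ∈ range (s + 2), Ring.choose (β i) (s + 1 - i) ≤ 0) :
    ∀ j, β (j + 1) < β j := by
  have key : ∀ j, ∃ c : ℤ, ∀ s, coeff (s + 1)
      ((cascadeSeries fun i => β (j + i)) * PowerSeries.binomialSeries ℤ c) ≤ 0 := by
    intro j
    induction j with
    | zero =>
      refine ⟨0, fun s => ?_⟩
      rw [binomialSeries_zero, mul_one, cascadeSeries, coeff_mk]
      simpa using h s
    | succ j ih =>
      obtain ⟨c, hc⟩ := ih
      refine ⟨-β j, ?_⟩
      simpa only [add_zero, add_assoc, add_comm 1] using (cascadeSeries_step hc).2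
  intro j
  obtain ⟨c, hc⟩ := key j
  -- After one step the exponent is -β j, so the inequality from the next step reads β (j + 1) < β
  -- j.
  simpa only [add_zero, zero_add, neg_neg] using (cascadeSeries_step (cascadeSeries_step hc).2).1

end series

/-! ### The integer solution of the triangular system -/

section beta

open Finset

/-- The integers `β j` with `v m = ∑ j ≤ m, (β j choose (m - j))` for all `m`. -/
noncomputable def cascadeCoeff (v : ℕ → ℤ) : ℕ → ℤ
  | m => v (m + 1) - 1 - ∑ j : Fin m, Ring.choose (cascadeCoeff v j) (m + 1 - j)
decreasing_by exact j.2

theorem cascadeCoeff_eq (v : ℕ → ℤ) (m : ℕ) :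
    cascadeCoeff v m = v (m + 1) - 1 -
      ∑ j ∈ range m, Ring.choose (cascadeCoeff v j) (m + 1 - j) := by
  rw [cascadeCoeff, Fin.sum_univ_eq_sum_range
    (fun j => Ring.choose (cascadeCoeff v j) (m + 1 - j))]

theorem sum_choose_succ (β : ℕ → ℤ) (m : ℕ) :
    ∑ j ∈ range (m + 2), Ring.choose (β j) (m + 1 - j) =
      ∑ j ∈ range m, Ring.choose (β j) (m + 1 - j) + β m + 1 := by
  rw [sum_range_succ, sum_range_succ]
  simp

theorem sum_choose_cascadeCoeff {v : ℕ → ℤ} (h0 : v 0 = 1) (m : ℕ) :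
    v m = ∑ j ∈ range (m + 1), Ring.choose (cascadeCoeff v j) (m - j) := by
  rcases m with _ | m
  · simp [h0]
  · rw [sum_choose_succ, cascadeCoeff_eq v m]; ring

theorem sum_choose_toNat {β : ℕ → ℤ} {p : ℕ} (h : ∀ j < p, 0 ≤ β j) (f : ℕ → ℕ) :
    ∑ j ∈ range p, Ring.choose (β j) (f j) =
      ((∑ j ∈ range p, (β j).toNat.choose (f j) : ℕ) : ℤ) := by
  rw [Nat.cast_sum]
  refine sum_congr rfl fun j hj => ?_
  rw [← Ring.choose_natCast, Int.toNat_of_nonneg (h j (mem_range.1 hj))]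

variable {v : ℕ → ℕ} {β : ℕ → ℤ}

theorem eq_cascade_add_one
    (hβ : ∀ m, (v m : ℤ) = ∑ j ∈ range (m + 1), Ring.choose (β j) (m - j)) {m : ℕ}
    (h : ∀ j < m, 0 ≤ β j) : v m = ∑ j ∈ range m, (β j).toNat.choose (m - j) + 1 := by
  have h1 := hβ m
  rw [sum_range_succ, Nat.sub_self, Ring.choose_zero_right, sum_choose_toNat h] at h1
  exact_mod_cast h1

theorem toNat_lt_toNat {p : ℕ} (h : ∀ j < p, 0 ≤ β j) (hb : ∀ j, j + 1 < p → β (j + 1) < β j) :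
    ∀ j, j + 1 < p → (β (j + 1)).toNat < (β j).toNat := by
  intro j hj
  have := h (j + 1) hj
  have := hb j hj
  omega

/-- Apart from a common cascade, v(m+2) contributes β (m+1) + 1 and its Kruskal–Katona bound
contributes β m. -/
theorem cascade_lt_of_nonneg (hv : ∀ m, v (m + 2) ≤ kkUpper (m + 1) (v (m + 1)))
    (hβ : ∀ m, (v m : ℤ) = ∑ j ∈ range (m + 1), Ring.choose (β j) (m - j)) {m : ℕ}
    (h : ∀ j < m + 1, 0 ≤ β j) (hb : ∀ j, j + 1 < m + 1 → β (j + 1) < β j) :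
    β (m + 1) < β m := by
  have h1 := hv m
  rw [eq_cascade_add_one hβ h, kkUpper_cascade_add_one (toNat_lt_toNat h hb)] at h1
  have h2 := hβ (m + 2)
  rw [sum_choose_succ, sum_choose_toNat h (fun j => m + 1 + 1 - j)] at h2
  have h3 := h m (by omega)
  have h4 : (v (m + 2) : ℤ) ≤ ((∑ j ∈ range (m + 1), (β j).toNat.choose (m + 2 - j) : ℕ) : ℤ) +
    (β m).toNat := by exact_mod_cast h1
  rw [Int.toNat_of_nonneg h3] at h4
  linarith

/-- If the term of index `p` is the first negative one, the initial cascade is an upper bound. -/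
theorem le_cascade_of_neg (hv : ∀ m, v (m + 2) ≤ kkUpper (m + 1) (v (m + 1)))
    (hβ : ∀ m, (v m : ℤ) = ∑ j ∈ range (m + 1), Ring.choose (β j) (m - j)) {p : ℕ}
    (h : ∀ j < p, 0 ≤ β j) (hb : ∀ j, j + 1 < p → β (j + 1) < β j) (hp : β p < 0) (i : ℕ) :
    v (p + i + 1) ≤ ∑ j ∈ range p, (β j).toNat.choose (p + i + 1 - j) := by
  induction i with
  | zero =>
    have h1 := hβ (p + 1)
    rw [sum_choose_succ, sum_choose_toNat h (fun j => p + 1 - j)] at h1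
    zify
    simp only [add_zero, Nat.cast_sum] at h1 ⊢
    linarith
  | succ i ih =>
    refine (hv (p + i)).trans ((kkUpper_mono _ ih).trans ?_)
    rw [kkUpper_cascade (by omega) (toNat_lt_toNat h hb)]
    exact le_rfl

/-- Up to the first negative term p, Kruskal–Katona compares consecutive terms. Beyond it,
subtracting the first p terms from v leaves nonpositive sums, and the series argument takes over. -/
theorem strictAnti_cascade (hv : ∀ m, v (m + 2) ≤ kkUpper (m + 1) (v (m + 1)))
    (hβ : ∀ m, (v m : ℤ) = ∑ j ∈ range (m + 1), Ring.choose (β j) (m - j)) :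
    ∀ j, β (j + 1) < β j := by
  have key : ∀ m, (∀ j < m + 1, 0 ≤ β j) → ∀ j < m + 1, β (j + 1) < β j := by
    intro m
    induction m with
    | zero =>
      intro h j hj
      obtain rfl : j = 0 := by omega
      exact cascade_lt_of_nonneg hv hβ h (by omega)
    | succ m ih =>
      intro h j hj
      have h1 := ih fun j hj => h j (by omega)
      rcases (Nat.lt_succ_iff.1 hj).lt_or_eq with hj | rfl
      · exact h1 j hj
      · exact cascade_lt_of_nonneg hv hβ h fun j hj => h1 j (by omega)
  by_cases hall : ∀ j, 0 ≤ β j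
  · exact fun j => key j (fun i _ => hall i) j (by omega)
  push Not at hall
  classical
  obtain ⟨p, hp, hmin⟩ : ∃ p, β p < 0 ∧ ∀ j < p, 0 ≤ β j :=
    ⟨Nat.find hall, Nat.find_spec hall, fun j hj => not_lt.1 (Nat.find_min hall hj)⟩
  have hb : ∀ j < p, β (j + 1) < β j := by
    rcases p with _ | p
    · omega
    · exact key p hmin
  have htail : ∀ s, ∑ i ∈ range (s + 2), Ring.choose (β (p + i)) (s + 1 - i) ≤ 0 := by
    intro s
    have h1 := hβ (p + s + 1)
    rw [show p + s + 1 + 1 = p + (s + 2) by ring, sum_range_add,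
      sum_choose_toNat hmin (fun j => p + s + 1 - j)] at h1
    have h2 := le_cascade_of_neg hv hβ hmin (fun j hj => hb j (by omega)) hp s
    have h3 : ∑ i ∈ range (s + 2), Ring.choose (β (p + i)) (p + s + 1 - (p + i)) =
        ∑ i ∈ range (s + 2), Ring.choose (β (p + i)) (s + 1 - i) :=
      sum_congr rfl fun i _ => by rw [show p + s + 1 - (p + i) = s + 1 - i by omega]
    rw [h3] at h1
    zify at h2
    push_cast at h1
    linarith
  have h4 := strictAnti_of_cascade_nonpos (β := fun i => β (p + i)) htail
  intro j
  rcases Nat.lt_or_ge j p with hj | hj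
  · exact hb j hj
  · obtain ⟨i, rfl⟩ := Nat.exists_eq_add_of_le hj
    exact h4 i

end beta

/-! ### Families, minimal shadows and extremality -/

section families

open Finset

variable {n k : ℕ} {S : Finset (Finset (Fin n))}

theorem shadow_iterate_subset_powersetCard (hS : S ⊆ univ.powersetCard k) {i m : ℕ}
    (h : i + m = k) : shadow^[i] S ⊆ univ.powersetCard m := by
  induction i generalizing m with
  | zero => obtain rfl : m = k := by omega
            exact hS
  | succ i ih =>
    rw [Function.iterate_succ_apply']
    exact shadow_subset_powersetCard (ih (m := m + 1) (by omega))

/-- The number of `m`-sets in the complex generated by a family `S` of `k`-sets. -/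
def shadowVector (k : ℕ) (S : Finset (Finset (Fin n))) (m : ℕ) : ℕ :=
  -- The value 0 above k keeps the Kruskal–Katona inequalities valid for all m, so the coefficients
  -- form an infinite sequence.
  if m ≤ k then #(shadow^[k - m] S) else 0

theorem shadowVector_zero (hS : S ⊆ univ.powersetCard k) (hne : S.Nonempty) :
    shadowVector k S 0 = 1 := by
  rw [shadowVector, if_pos (Nat.zero_le _), Nat.sub_zero, card_eq_one]
  refine ⟨∅, eq_singleton_iff_unique_mem.2 ⟨?_, fun D hD => ?_⟩⟩
  · obtain ⟨D, hD⟩ := hne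
    exact mem_shadow_iterate_iff_exists_sdiff.2 ⟨D, hD, empty_subset _, by
      rw [sdiff_empty]; exact (mem_powersetCard.1 (hS hD)).2⟩
  · exact card_eq_zero.1
      (mem_powersetCard.1 (shadow_iterate_subset_powersetCard hS (add_zero k) hD)).2

theorem shadowVector_le (hS : S ⊆ univ.powersetCard k) (m : ℕ) :
    shadowVector k S (m + 2) ≤ kkUpper (m + 1) (shadowVector k S (m + 1)) := by
  by_cases h : m + 2 ≤ k
  · rw [shadowVector, shadowVector, if_pos h, if_pos (by omega),
      show k - (m + 1) = (k - (m + 2)) + 1 by omega, Function.iterate_succ_apply']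
    exact card_le_kkUpper_card_shadow (Nat.succ_pos m)
      (shadow_iterate_subset_powersetCard hS (by omega))
  · rw [shadowVector, if_neg h]
    exact Nat.zero_le _

/-- The shadow inherits minimality, so only the last coefficient is in doubt. Were it negative, |S|
would be at most the clique maximum for A = |ΔS| - 1 sets; |S| cliques of an extremal family of that
size would have a smaller shadow. -/
theorem nonneg_of_hasMinimalShadow {β : ℕ → ℤ} (hS : S ⊆ univ.powersetCard (k + 1))
    (hne : S.Nonempty) (h : HasMinimalShadow (k + 1) S)
    (hβ : ∀ m ≤ k + 1, (#(shadow^[k + 1 - m] S) : ℤ) =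
      ∑ j ∈ range (m + 1), Ring.choose (β j) (m - j))
    (hb : ∀ j, j + 1 < k + 1 → β (j + 1) < β j) : ∀ j < k + 1, 0 ≤ β j := by
  induction k generalizing S with
  | zero =>
    intro j hj
    obtain rfl : j = 0 := by omega
    have h1 := hβ 1 le_rfl
    rw [sum_choose_succ] at h1
    have h2 := card_pos.2 hne
    simp only [zero_add, Nat.sub_self, Function.iterate_zero, id_eq, range_zero, sum_empty] at h1
    omega
  | succ k ih =>
    have hsh := shadow_subset_powersetCard hS
    have hsne : S.shadow.Nonempty := by
      obtain ⟨D, hD⟩ := hne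
      obtain ⟨x, hx⟩ : D.Nonempty := card_pos.1 (by rw [(mem_powersetCard.1 (hS hD)).2]; omega)
      exact ⟨_, erase_mem_shadow hD hx⟩
    have hpre := ih hsh hsne (h.shadow hS) (fun m hm => by
      rw [← hβ m (by omega), show k + 1 + 1 - m = (k + 1 - m) + 1 by omega,
        Function.iterate_succ_apply]) fun j hj => hb j (by omega)
    intro j hj
    rcases (Nat.lt_succ_iff.1 hj).lt_or_eq with hj | rfl
    · exact hpre j hj
    by_contra! hneg
    have h1 := hβ (k + 2) le_rfl
    have h2 := hβ (k + 1) (by omega)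
    rw [sum_choose_succ, sum_choose_toNat hpre (fun j => k + 1 + 1 - j)] at h1
    rw [sum_range_succ, Nat.sub_self, Ring.choose_zero_right, sum_choose_toNat hpre] at h2
    have e : k + 1 + 1 - (k + 1) = 1 := by omega
    rw [e, Function.iterate_one] at h2
    simp only [Nat.sub_self, Function.iterate_zero, id_eq] at h1
    set A := ∑ j ∈ range (k + 1), (β j).toNat.choose (k + 1 - j) with hA
    have hF : kkUpper (k + 1) A = ∑ j ∈ range (k + 1), (β j).toNat.choose (k + 2 - j) :=
      kkUpper_cascade le_rfl (toNat_lt_toNat hpre fun j hj => hb j (by omega))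
    have hle := card_le_card hsh
    rw [card_powersetCard] at hle
    obtain ⟨W, hW, hW1, hW2, -⟩ := exists_card_cliques_eq (univ : Finset (Fin n)) k A (by omega)
    have hSle : #S ≤ #(cliques univ (k + 1) W) := by
      rw [hW2, hF]
      zify
      push_cast at h1
      linarith
    obtain ⟨S', hS', hS'c⟩ := exists_subset_card_eq hSle
    have h3 := h S' (hS'.trans cliques_subset_powersetCard) hS'c
    have h4 := card_le_card ((shadow_mono hS').trans (shadow_cliques_subset W))
    omega

/-- A shadow below the cascade value would, by `kkUpper_lt_cascade`, support fewer than |S| sets. -/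
theorem IsKruskalKatonaExtremal.hasMinimalShadow
    (h : IsKruskalKatonaExtremal (k + 2) S) : HasMinimalShadow (k + 2) S := by
  obtain ⟨t, a, ⟨ht, ha, hat, hc⟩, hsh⟩ := h
  intro S' hS' hcard
  by_contra! hlt
  set b : ℕ → ℕ := fun j => if h : j < t + 1 then a ⟨j, h⟩ else 0 with hb
  have hba : ∀ i : Fin (t + 1), a i = b i := fun i => by rw [hb]; simp only [i.2, dif_pos]
  simp only [hba] at hc hsh
  rw [Fin.sum_univ_eq_sum_range (fun j => (b j).choose (k + 2 - j))] at hc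
  rw [Fin.sum_univ_eq_sum_range (fun j => (b j).choose (k + 2 - j - 1))] at hsh
  have h1 : #S'.shadow < ∑ j ∈ range (t + 1), (b j).choose (k + 1 - j) := by
    refine hlt.trans_eq (hsh.trans (sum_congr rfl fun j _ => ?_))
    rw [show k + 2 - j - 1 = k + 1 - j by omega]
  have h2 := kkUpper_lt_cascade (by omega) (fun j hj => ?_) ?_ h1
  · have h3 := card_le_kkUpper_card_shadow (Nat.succ_pos k) hS'
    rw [← hc, ← hcard] at h2
    exact absurd h3 (not_le.2 h2)
  · have := @ha ⟨j, by omega⟩ ⟨j + 1, hj⟩ (by simp [Fin.lt_def])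
    rwa [hba, hba] at this
  · rwa [hba, Fin.val_last] at hat

theorem isKruskalKatonaExtremal_of_cascade {b : ℕ → ℕ}
    (hb : ∀ j, j + 1 < k + 1 → b (j + 1) < b j)
    (hc : #S = ∑ j ∈ range (k + 1), (b j).choose (k + 1 - j) + 1)
    (hsh : #S.shadow = ∑ j ∈ range k, (b j).choose (k - j) + 1) :
    IsKruskalKatonaExtremal (k + 1) S := by
  obtain ⟨t, a, h1, h2, h3, h4, h5, -⟩ := exists_cascade_eq_add_one hb
  refine ⟨t, fun i => a i, ⟨h1, ?_, h3, ?_⟩, ?_⟩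
  · refine Fin.strictAnti_iff_succ_lt.2 fun i => ?_
    simpa using h2 i (by omega)
  · rw [Fin.sum_univ_eq_sum_range (fun j => (a j).choose (k + 1 - j)), hc, h4]
  · rw [Fin.sum_univ_eq_sum_range (fun j => (a j).choose (k + 1 - j - 1)), hsh, h5]
    exact sum_congr rfl fun j _ => by rw [show k + 1 - j - 1 = k - j by omega]

/-- The constant 1 is the term j = m + 1, which falls outside the index range exactly when m = k. -/
theorem sum_intBinom (f : ℕ → ℤ) {m : ℕ} (hm : m ≤ k) :
    ∑ j : Fin (k + 1), intBinom (f j) ((m : ℤ) + 1 - (j : ℕ)) =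
      ∑ j ∈ range m, Ring.choose (f j) (m + 1 - j) + f m + if m = k then 0 else 1 := by
  rw [Fin.sum_univ_eq_sum_range (fun j => intBinom (f j) ((m : ℤ) + 1 - (j : ℕ)))]
  have hchoose : ∀ j ≤ m + 1, intBinom (f j) ((m : ℤ) + 1 - (j : ℕ)) =
      Ring.choose (f j) (m + 1 - j) := by
    intro j hj
    rw [intBinom, if_neg (by omega), show ((m : ℤ) + 1 - (j : ℕ)).toNat = m + 1 - j by omega]
  have hsum : ∀ p ≤ m + 2, ∑ j ∈ range p, intBinom (f j) ((m : ℤ) + 1 - (j : ℕ)) =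
      ∑ j ∈ range p, Ring.choose (f j) (m + 1 - j) := fun p hp =>
    sum_congr rfl fun j hj => hchoose j (by rw [mem_range] at hj; omega)
  split_ifs with h
  · subst h
    rw [hsum _ (by omega), sum_range_succ]
    simp
  · rw [← sum_choose_succ, ← hsum _ le_rfl]
    refine (sum_subset (range_mono (by omega)) fun j _ hj => ?_).symm
    rw [mem_range] at hj
    rw [intBinom, if_pos (by omega)]

end families

/-! ### The theorem -/

theorem theorem3 (n k : ℕ) (hk : 0 < k) (S : Finset (Finset (Fin n)))
    (hS : ∀ s ∈ S, s.card = k) (hne : S.Nonempty) :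
    (∃! β : Fin k → ℤ, IsShadowBinomialDecomposition S β) ∧
    ∀ β : Fin k → ℤ, IsShadowBinomialDecomposition S β →
      (IsKruskalKatonaExtremal k S ↔ 1 ≤ β ⟨k - 1, Nat.sub_one_lt_of_lt hk⟩) := by
  obtain ⟨k, rfl⟩ : ∃ r, k = r + 1 := ⟨k - 1, by omega⟩
  replace hS : S ⊆ Finset.univ.powersetCard (k + 1) := fun D hD =>
    Finset.mem_powersetCard.2 ⟨Finset.subset_univ _, hS D hD⟩
  set β := cascadeCoeff (fun m => (shadowVector (k + 1) S m : ℤ)) with hβdef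
  have hβ : ∀ m, (shadowVector (k + 1) S m : ℤ) =
      ∑ j ∈ Finset.range (m + 1), Ring.choose (β j) (m - j) :=
    sum_choose_cascadeCoeff (by exact_mod_cast shadowVector_zero hS hne)
  have hanti : StrictAnti β :=
    strictAnti_nat_of_succ_lt (strictAnti_cascade (shadowVector_le hS) hβ)
  have hvec : ∀ m ≤ k + 1, (Finset.shadow^[k + 1 - m] S).card = shadowVector (k + 1) S m :=
    fun m hm => by rw [shadowVector, if_pos hm]
  have hsum : ∀ f : ℕ → ℤ, (∀ i : Fin (k + 1), (((Finset.shadow^[(i : ℕ)] S).card : ℕ) : ℤ) =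
      ∑ j : Fin (k + 1), intBinom (f j) (((k + 1 : ℕ) : ℤ) - ((i : ℕ) : ℤ) - ((j : ℕ) : ℤ))) ↔
      ∀ m ≤ k, (shadowVector (k + 1) S (m + 1) : ℤ) =
        ∑ j ∈ Finset.range m, Ring.choose (f j) (m + 1 - j) + f m + if m = k then 0 else 1 := by
    intro f
    constructor
    · intro h m hm
      have := h ⟨k - m, by omega⟩
      rw [← sum_intBinom f hm, ← hvec _ (by omega), show k + 1 - (m + 1) = k - m by omega, this]
      refine Finset.sum_congr rfl fun j _ => ?_
      congr 1
      simp only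
      omega
    · intro h i
      have := h (k - i) (by omega)
      rw [← sum_intBinom f (by omega), ← hvec _ (by omega),
        show k + 1 - (k - (i : ℕ) + 1) = i by omega] at this
      rw [this]
      refine Finset.sum_congr rfl fun j _ => ?_
      congr 1
      omega
  -- The last entry absorbs the constant 1 missing from the equation for |S|.
  set γ : ℕ → ℤ := fun j => β j + if j = k then 1 else 0 with hγ
  have hγlt : ∀ j, j ≠ k → γ j = β j := fun j hj => by simp [hγ, hj]
  have hγk : γ k = β k + 1 := by simp [hγ]
  have hexists : IsShadowBinomialDecomposition S (fun j : Fin (k + 1) => γ j) := by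
    refine ⟨fun i j hij => ?_, fun i j hij hj => ?_, (hsum γ).2 fun m hm => ?_⟩
    · rcases hij.eq_or_lt with rfl | hij
      · exact le_rfl
      · have h1 : (i : ℕ) < j := hij
        have h2 := hanti h1
        simp only
        rw [hγlt i (by omega)]
        simp only [hγ]
        split_ifs <;> omega
    · have h1 : (i : ℕ) < j := hij
      simp only
      rw [hγlt i (by omega), hγlt j (by omega)]
      exact hanti h1
    · have h1 : ∑ j ∈ Finset.range m, Ring.choose (γ j) (m + 1 - j) =
          ∑ j ∈ Finset.range m, Ring.choose (β j) (m + 1 - j) := Finset.sum_congr rfl fun j hj => by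
        rw [hγlt j (by rw [Finset.mem_range] at hj; omega)]
      rw [hβ, sum_choose_succ, h1]
      simp only [hγ]
      split_ifs <;> ring
  have hunique : ∀ δ : Fin (k + 1) → ℤ, IsShadowBinomialDecomposition S δ →
      δ = fun j : Fin (k + 1) => γ j := by
    rintro δ ⟨-, -, hδ⟩
    set f : ℕ → ℤ := fun j => if h : j < k + 1 then δ ⟨j, h⟩ else 0 with hf
    have hδf : ∀ i : Fin (k + 1), δ i = f i := fun i => by rw [hf]; simp only [i.2, dif_pos]
    simp only [hδf] at hδ
    have h1 := (hsum f).1 hδ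
    have h2 := (hsum γ).1 hexists.2.2
    have key : ∀ m, m ≤ k → f m = γ m := by
      intro m
      induction m using Nat.strong_induction_on with
      | _ m ih =>
        intro hm
        have h3 := h1 m hm
        have h4 : ∑ j ∈ Finset.range m, Ring.choose (f j) (m + 1 - j) =
            ∑ j ∈ Finset.range m, Ring.choose (γ j) (m + 1 - j) :=
          Finset.sum_congr rfl fun j hj => by
            have hj := Finset.mem_range.1 hj
            rw [ih j hj (by omega)]
        rw [h2 m hm, h4] at h3
        linarith
    funext i
    rw [hδf, key i (by omega)]
  refine ⟨⟨_, hexists, hunique⟩, fun δ hδ => ?_⟩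
  rw [hunique δ hδ]
  simp only [Nat.add_sub_cancel]
  rw [hγk, le_add_iff_nonneg_left]
  constructor
  · intro h
    -- In rank 1 the last coefficient is |S| - 1, which is nonnegative as S is nonempty.
    rcases k with _ | k
    · have h1 := hβ 1
      rw [sum_choose_succ, ← hvec 1 le_rfl] at h1
      have h2 := Finset.card_pos.2 hne
      simp only [zero_add, Nat.sub_self, Function.iterate_zero, id_eq, Finset.range_zero,
        Finset.sum_empty] at h1
      omega
    · exact nonneg_of_hasMinimalShadow hS hne h.hasMinimalShadow (fun m hm => by rw [hvec m hm, hβ])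
        (fun j _ => hanti (Nat.lt_succ_self j)) (k + 1) (by omega)
  · intro h
    have hnn : ∀ j < k + 1, 0 ≤ β j := fun j hj => h.trans (hanti.antitone (by omega))
    refine isKruskalKatonaExtremal_of_cascade (b := fun j => (β j).toNat)
      (toNat_lt_toNat hnn fun j _ => hanti (Nat.lt_succ_self j)) ?_ ?_
    · have h1 := hβ (k + 1)
      rw [← hvec _ le_rfl, Finset.sum_range_succ, Nat.sub_self, Ring.choose_zero_right,
        sum_choose_toNat hnn] at h1
      simp only [Function.iterate_zero, id_eq] at h1
      exact_mod_cast h1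
    · have h1 := hvec k (by omega)
      rw [Nat.add_sub_cancel_left, Function.iterate_one] at h1
      rw [h1]
      exact eq_cascade_add_one hβ fun j hj => hnn j (by omega)
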